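/- Let $H$ be a separable real Hilbert space with inner product $\langle\cdot,\cdot\rangle$, let $A:D(A)\subset H\to H$ be self-adjoint with $\langle Ax,x\rangle\ge\delta|x|^2$ for all $x \in D(A)$ and some $\delta>0$, and suppose that $A^{-1}$ is of trace class. Let $(e_j)_j$ be an orthonormal basis of $H$ consisting of eigenvectors of $A$, let $c_j\in[1,\infty)$, and let $H_1=\{x\in H:\sum_j c_j^2\langle x,e_j\rangle^2<\infty\}$ with $\langle x,y\rangle_{H_1}=\sum_j c_j^2\langle x,e_j\rangle\langle y,e_j\rangle$, and with dual $H_1^*$ and dual pairing ${}_{H_1}\langle\cdot,\cdot\rangle_{H_1^*}$. Let $\mu$ be the centered Gaussian measure on $H$ with covariance operator $\frac12A^{-1}$. Let $C_b^1(H)$ be the set of bounded Fréchet differentiable functions $H\to\mathbb R$ with bounded derivative, $D$ the Fréchet derivative (identified with the gradient), and $D^*$ the adjoint of $D:C_b^1(H)\subset L^2(H;\mu)\to L^2(H,H;\mu)$. Let $\mathcal G$ be the set of all $G=\sum_{j=1}^m g_j l^j$ with $m\in\mathbb N$, $g_j\in C_b^1(H)$, $l^j\in D(A)\cap H_1$,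 and put $$V(f)=\sup\Big\{\int_H D^*G\, f\,d\mu : G\in\mathcal G,\ |G(z)|_{H_1}\le1\ \text{for all } z\in H\Big\}.$$ Write $f\in BV(H,H_1)$ if $f$ is Borel measurable, $A_{1/2}(|f|)\in L^1(H;\mu)$ where $A_{1/2}(x)=\int_0^x(\log(1+s))^{1/2}ds$, and $V(f)<\infty$. For a closed convex set $\Gamma\subset H$ with $\mathbb I_\Gamma\in BV(H,H_1)$ let $\|\partial\Gamma\|$ (surface measure) and $\eta_\Gamma:H\to H_1^*$ (exterior normal) be the finite positive Borel measure on $\Gamma$, supported by $\partial\Gamma$, and the Borel map, unique $\|\partial\Gamma\|$-a.e., such that $|\eta_\Gamma|_{H_1^*}=1$ $\|\partial\Gamma\|$-a.e. on $\partial\Gamma$, $\|\partial\Gamma\|(\Gamma)=V(\mathbb I_\Gamma)$ and, for all $G\in\mathcal G$, $$\int_\Gamma D^*G\,d\mu=-\int_{\partial\Gamma}{}_{H_1}\langle G(z),\eta_\Gamma(z)\rangle_{H_1^*}\,\|\partial\Gamma\|(dz).$$ (Such a pair exists; this is part of the assertion.) Let $(\Gamma_{\alpha_k})_{k\in\mathbb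 Z}$ be an increasing sequence of closed convex subsets of $H$ with $\mathbb I_{\Gamma_{\alpha_k}}\in BV(H,H_1)$ for all $k$, $\lim_{k\to-\infty}\mu(\Gamma_{\alpha_k})=0$ and $\lim_{k\to\infty}\mu(\Gamma_{\alpha_k})=\mu(H)$. Let $(\gamma_k)_{k\in\mathbb Z}\subset(0,\infty)$ satisfy $1/c_0\le\gamma_k\le c_0$ for all $k$ and some $c_0>1$, suppose that $\lim_{k\to\infty}\gamma_k$ exists, and that $\sum_{k\in\mathbb Z}|\gamma_{k+1}-\gamma_k|\,\|\partial\Gamma_{\alpha_k}\|(\partial\Gamma_{\alpha_k})<\infty$. Put $\rho=\sum_{k\in\mathbb Z}\gamma_{k+1}\mathbb I_{\Gamma_{\alpha_{k+1}}\setminus\Gamma_{\alpha_k}}$, and let $(\mathcal E^\rho,D(\mathcal E^\rho))$ be the closure in $L^2(H;\rho\,d\mu)$ of $\mathcal E^\rho(u,v)=\frac12\int_H\langle Du,Dv\rangle\rho\,d\mu$, $u,v\in C_b^1(H)$. Then for all $l\in D(A)\cap H_1$ and $g\in C_b^1(H)$ the functions $l(\cdot)=\langle l,\cdot\rangle$ and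 $g$ belong to $D(\mathcal E^\rho)$, all integrals below exist, the series converges absolutely, and $$-\mathcal E^\rho(l(\cdot),g)=-\int_H g(z)\langle Al,z\rangle\rho(z)\,\mu(dz)+\sum_{k\in\mathbb Z}\int_{\partial\Gamma_{\alpha_k}}g(z)\;{}_{H_1}\langle l,\eta_{\Gamma_{\alpha_k}}(z)\rangle_{H_1^*}\,(\gamma_{k+1}-\gamma_k)\,\frac{\|\partial\Gamma_{\alpha_k}\|}{2}(dz).$$ -/

import Mathlib

open MeasureTheory ProbabilityTheory Filter Topology Set
open scoped ENNReal

noncomputable section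

namespace SkewOU

/-! ### The Gelfand triple and the operator `A⁻¹` -/

section Triple

variable {H : Type*} [NormedAddCommGroup H] [InnerProductSpace ℝ H] {ι : Type*}

lemma summable_weighted_mul {a x y : ι → ℝ} (hx : Summable fun j => a j ^ 2 * x j ^ 2)
    (hy : Summable fun j => a j ^ 2 * y j ^ 2) : Summable fun j => a j ^ 2 * (x j * y j) := by
  refine Summable.of_norm_bounded (hx.add hy) fun j => ?_
  rw [Real.norm_eq_abs, abs_le]
  constructor <;> nlinarith [mul_nonneg (sq_nonneg (a j)) (sq_nonneg (x j - y j)),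
    mul_nonneg (sq_nonneg (a j)) (sq_nonneg (x j + y j)),
    mul_nonneg (sq_nonneg (a j)) (sq_nonneg (x j)), mul_nonneg (sq_nonneg (a j)) (sq_nonneg (y j))]

/-- The linear subspace `{x ∈ H | ∑ⱼ cⱼ² ⟨x, eⱼ⟩² < ∞}` of `H`. -/
def h1Submodule (e : HilbertBasis ι ℝ H) (c : ι → Set.Ici (1 : ℝ)) : Submodule ℝ H where
  carrier := {x | Summable fun j => (c j : ℝ) ^ 2 * inner ℝ x (e j) ^ 2}
  zero_mem' := by simp
  add_mem' {x y} hx hy := by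
    have hxy := summable_weighted_mul (a := fun j => (c j : ℝ)) hx hy
    refine ((Summable.add hx hy).add (hxy.mul_left 2)).congr fun j => ?_
    simp only [inner_add_left]
    ring
  smul_mem' r x hx := by
    refine (Summable.mul_left (r ^ 2) hx).congr fun j => ?_
    simp only [real_inner_smul_left]
    ring

/-- The space `H₁`, as a type of its own (so that it carries its own norm, not that of `H`). -/
def H1 (e : HilbertBasis ι ℝ H) (c : ι → Set.Ici (1 : ℝ)) : Type _ := h1Submodule e c

variable (e : HilbertBasis ι ℝ H) (c : ι → Set.Ici (1 : ℝ))

instance : AddCommGroup (H1 e c) := inferInstanceAs (AddCommGroup (h1Submodule e c))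

instance : Module ℝ (H1 e c) := inferInstanceAs (Module ℝ (h1Submodule e c))

/-- The embedding `H₁ ⊂ H`. -/
def H1.incl : H1 e c →ₗ[ℝ] H := (h1Submodule e c).subtype

lemma H1.summable_incl (x : H1 e c) :
    Summable fun j => (c j : ℝ) ^ 2 * inner ℝ (H1.incl e c x) (e j) ^ 2 := x.2

lemma H1.summable_incl_mul (x y : H1 e c) : Summable fun j =>
    (c j : ℝ) ^ 2 * (inner ℝ (H1.incl e c x) (e j) * inner ℝ (H1.incl e c y) (e j)) :=
  summable_weighted_mul (a := fun j => (c j : ℝ)) (H1.summable_incl e c x) (H1.summable_incl e c y)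

/-- The inner product `⟨x, y⟩_{H₁} = ∑ⱼ cⱼ² ⟨x, eⱼ⟩ ⟨y, eⱼ⟩`. -/
@[reducible] def H1.core : InnerProductSpace.Core ℝ (H1 e c) where
  inner x y := ∑' j, (c j : ℝ) ^ 2 *
    (inner ℝ (H1.incl e c x) (e j) * inner ℝ (H1.incl e c y) (e j))
  conj_inner_symm x y := by
    simp only [conj_trivial]
    exact tsum_congr fun j => by ring
  re_inner_nonneg x := by
    simp only [RCLike.re_to_real]
    exact tsum_nonneg fun j => mul_nonneg (sq_nonneg _) (mul_self_nonneg _)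
  add_left x y z := by
    rw [← (H1.summable_incl_mul e c x z).tsum_add (H1.summable_incl_mul e c y z)]
    refine tsum_congr fun j => ?_
    simp only [map_add, inner_add_left]
    ring
  smul_left x y r := by
    simp only [conj_trivial]
    rw [← tsum_mul_left]
    refine tsum_congr fun j => ?_
    simp only [map_smul, real_inner_smul_left]
    ring
  definite x hx := by
    have h0 := (hasSum_zero_iff_of_nonneg
      (fun j => mul_nonneg (sq_nonneg (c j : ℝ))
        (mul_self_nonneg (inner ℝ (H1.incl e c x) (e j))))).1
      (hx ▸ (H1.summable_incl_mul e c x x).hasSum)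
    have h1 : ∀ j, inner ℝ (e j) (H1.incl e c x) = 0 := fun j => by
      have hj := congrFun h0 j
      have hc : (c j : ℝ) ≠ 0 := (lt_of_lt_of_le one_pos (c j).2).ne'
      rw [real_inner_comm]
      simpa [hc] using hj
    have h2 : H1.incl e c x = 0 := by
      apply e.repr.injective
      ext j
      simp [e.repr_apply_apply, h1 j]
    exact Subtype.ext h2

instance : NormedAddCommGroup (H1 e c) := (H1.core e c).toNormedAddCommGroup

instance : InnerProductSpace ℝ (H1 e c) := InnerProductSpace.ofCore (H1.core e c).toCore

/-- `T` is the bounded, everywhere defined inverse of the operator `A`. -/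
def IsInverse (A : H →ₗ.[ℝ] H) (T : H →L[ℝ] H) : Prop :=
  (∀ x : H, ∃ h : T x ∈ A.domain, A ⟨T x, h⟩ = x) ∧ ∀ x : A.domain, T (A x) = x

/-- Trace class operators on a Hilbert space: `T = ∑ₙ ⟨xₙ, ·⟩ yₙ` with `∑ₙ |xₙ| |yₙ| < ∞`. -/
def IsTraceClass (T : H →L[ℝ] H) : Prop :=
  ∃ x y : ℕ → H, (Summable fun n => ‖x n‖ * ‖y n‖) ∧
    ∀ z, HasSum (fun n => inner ℝ (x n) z • y n) (T z)

end Triple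

/-! ### Functions of bounded variation in the Gelfand triple -/

section BV

variable {H : Type*} [NormedAddCommGroup H] [InnerProductSpace ℝ H] [CompleteSpace H]

/-- The class `C_b^1(H)`: bounded Fréchet differentiable functions with bounded derivative. -/
def IsCb1 (f : H → ℝ) : Prop :=
  Differentiable ℝ f ∧ (∃ C, ∀ z, |f z| ≤ C) ∧ ∃ C, ∀ z, ‖fderiv ℝ f z‖ ≤ C

variable [MeasurableSpace H] (μ : Measure H)

/-- `w ∈ L²(H; μ)` represents the adjoint of `D : C_b^1(H) ⊂ L²(H; μ) → L²(H, H; μ)` at `G`. -/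
def IsAdjointAt (G : H → H) (w : H → ℝ) : Prop :=
  MemLp G 2 μ ∧ MemLp w 2 μ ∧
    ∀ u : H → ℝ, IsCb1 u → ∫ z, w z * u z ∂μ = ∫ z, inner ℝ (G z) (gradient u z) ∂μ

open Classical in
/-- `D^* G`, for `G` in the domain of the adjoint `D^*` of `D` (and `0` for other `G`). -/
def adjointD (G : H → H) : H → ℝ :=
  if h : ∃ w, IsAdjointAt μ G w then h.choose else 0

/-- The function `A_{1/2}(x) = ∫₀ˣ (log (1 + s))^{1/2} ds`. -/
def orliczHalf (x : ℝ) : ℝ := ∫ s in (0 : ℝ)..x, √(Real.log (1 + s))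

/-- The Orlicz space `L (log L)^{1/2}(H, μ)`. -/
def MemLLogLHalf (f : H → ℝ) : Prop :=
  Measurable f ∧ Integrable (fun z => orliczHalf |f z|) μ

variable {ι : Type*} (A : H →ₗ.[ℝ] H) (e : HilbertBasis ι ℝ H) (c : ι → Set.Ici (1 : ℝ))

/-- The class `(C_b^1)_{D(A) ∩ H₁}` of vector fields `G = ∑_{j ≤ m} gⱼ lʲ` with `gⱼ ∈ C_b^1(H)` and
`lʲ ∈ D(A) ∩ H₁`. -/
def IsTestField (G : H → H1 e c) : Prop :=
  ∃ (m : ℕ) (g : Fin m → H → ℝ) (l : Fin m → H1 e c),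
    (∀ j, IsCb1 (g j)) ∧ (∀ j, H1.incl e c (l j) ∈ A.domain) ∧ ∀ z, G z = ∑ j, g j z • l j

/-- `V(ρ) = sup {∫ D^*G ρ dμ | G ∈ (C_b^1)_{D(A) ∩ H₁}, |G|_{H₁} ≤ 1}`. -/
def variationBV (ρ : H → ℝ) : EReal :=
  ⨆ G : {G : H → H1 e c // IsTestField A e c G ∧ ∀ z, ‖G z‖ ≤ 1},
    ((∫ z, adjointD μ (fun x => H1.incl e c (G.1 x)) z * ρ z ∂μ : ℝ) : EReal)

/-- `ρ ∈ BV(H, H₁)`. -/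
def IsBV (ρ : H → ℝ) : Prop :=
  MemLLogLHalf μ ρ ∧ variationBV μ A e c ρ < ⊤

/-- The characterization of the surface measure `‖∂Γ‖` and of the exterior normal
`η_Γ : H → H₁^*` of a set `Γ`. -/
structure IsSurfacePair (Γ : Set H) (ν : Measure H) (η : H → StrongDual ℝ (H1 e c)) : Prop where
  finite : IsFiniteMeasure ν
  concentrated : ν Γᶜ = 0
  concentrated_frontier : ν (frontier Γ)ᶜ = 0
  measurable_normal : Measurable η
  norm_normal : ∀ᵐ z ∂ν.restrict (frontier Γ), ‖η z‖ = 1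
  total_mass : ((ν Γ : ℝ≥0∞) : EReal) = variationBV μ A e c (Γ.indicator 1)
  gauss : ∀ G : H → H1 e c, IsTestField A e c G →
    ∫ z in Γ, adjointD μ (fun x => H1.incl e c (G x)) z ∂μ = -∫ z in frontier Γ, η z (G z) ∂ν

open Classical in
/-- The surface measure and the exterior normal of `Γ`: the pair described by `IsSurfacePair`
(and `0` if there is none). -/
def surfacePair (Γ : Set H) : Measure H × (H → StrongDual ℝ (H1 e c)) :=
  if h : ∃ p : Measure H × (H → StrongDual ℝ (H1 e c)), IsSurfacePair μ A e c Γ p.1 p.2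
  then h.choose else 0

/-- The surface measure `‖∂Γ‖`. -/
def surfaceMeasure (Γ : Set H) : Measure H := (surfacePair μ A e c Γ).1

/-- The exterior normal `η_Γ`. -/
def exteriorNormal (Γ : Set H) : H → StrongDual ℝ (H1 e c) := (surfacePair μ A e c Γ).2

end BV

/-! ### The Dirichlet form -/

section Form

variable {H : Type*} [NormedAddCommGroup H] [InnerProductSpace ℝ H] [CompleteSpace H]
  [MeasurableSpace H] (μ : Measure H) (ρ : H → ℝ)

/-- The pre-Dirichlet form `½ ∫ ⟨Du, Dv⟩ ρ dμ` on `C_b^1(H)`. -/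
def preForm (u v : H → ℝ) : ℝ :=
  (1 / 2) * ∫ z, inner ℝ (gradient u z) (gradient v z) * ρ z ∂μ

/-- The measure `ρ dμ`. -/
def weighted : Measure H := μ.withDensity fun z => ENNReal.ofReal (ρ z)

/-- `w` is a sequence in `C_b^1(H)` that is Cauchy for the form and converges to `u` in
`L²(H; ρ dμ)`. -/
def IsApproximating (w : ℕ → H → ℝ) (u : H → ℝ) : Prop :=
  (∀ n, IsCb1 (w n)) ∧
  Tendsto (fun p : ℕ × ℕ => preForm μ ρ (w p.1 - w p.2) (w p.1 - w p.2)) atTop (𝓝 0) ∧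
  Tendsto (fun n => eLpNorm (w n - u) 2 (weighted μ ρ)) atTop (𝓝 0)

/-- The domain `D(ℰ^ρ)` of the closure of the form in `L²(H; ρ dμ)`. -/
def MemFormDomain (u : H → ℝ) : Prop :=
  MemLp u 2 (weighted μ ρ) ∧ ∃ w, IsApproximating μ ρ w u

open Classical in
/-- The closure `ℰ^ρ`: the limit of `ℰ^ρ(uₙ, vₙ)` along approximating sequences (and `0` outside
the domain). -/
def closedForm (u v : H → ℝ) : ℝ :=
  if h : MemFormDomain μ ρ u ∧ MemFormDomain μ ρ v then
    limUnder atTop fun n => preForm μ ρ (h.1.2.choose n) (h.2.2.choose n)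
  else 0

/-- The step function `ρ = ∑ₖ γ_{k+1} 𝟙_{Γ_{k+1} ∖ Γ_k}`. -/
def stepDensity {X : Type*} (Γ : ℤ → Set X) (γ : ℤ → ℝ) (z : X) : ℝ :=
  ∑' k : ℤ, (Γ (k + 1) \ Γ k).indicator (fun _ => γ (k + 1)) z

end Form

end SkewOU

end

open SkewOU

/-! Gaussian integration by parts with covariance `½ A⁻¹` gives `D^*l = 2⟨Al, ·⟩` for `l ∈ D(A)`,
and the product rule gives `F := D^*(g l) = 2 g ⟨Al, ·⟩ - ⟨l, Dg⟩`, a function of mean zero. The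
functional `⟨l, ·⟩` has constant gradient `l`, so `ℰ^ρ(l, g) = ½ ∫ ⟨l, Dg⟩ ρ dμ` and `∫ F ρ dμ = 2 ∫
g ⟨Al, ·⟩ ρ dμ - 2 ℰ^ρ(l, g)`. Abel summation over the rings `Γ (k + 1) \ Γ k` turns the left side
into `-∑ₖ (γ (k + 1) - γ k) ∫_{Γ k} F dμ` (`integral_mul_stepDensity`), and the Gauss formula on
each `Γ k` makes every summand a surface integral. Half of this identity is the theorem.

The form closes because `ρ` is bounded and bounded away from zero almost everywhere: pairing
gradients with `ρ⁻¹ v e j` cancels the density and leaves integration by parts for `μ`, so the limit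
of the gradients depends only on the limit function (`IsApproximating.limit_unique`).

The main work is the existence of the surface pair (`exists_isSurfacePair`). With `flux G = ∫_Γ D^*G
dμ`, choose test fields `G n` of norm at most one whose flux tends to the supremum `V`. The
ultralimit of `flux (u • G n)` is a functional `Λ u` on `C_b^1(H)` with `Λ 1 = V`, `|Λ u| ≤ V sup
|u|`, and `flux G ≤ Λ u` whenever `‖G‖ ≤ u`. Hahn–Banach and Riesz–Markov–Kakutani represent `Λ` by
a measure on the Stone–Čech compactification; tightness along cut-off functions places it on `H`
(`IsVariationFunctional.exists_measure`). For this measure `ν` one has `flux G ≤ ∫ ‖G‖ dν`, so the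
flux extends to a continuous functional on `L²(ν; H₁)` and has a density `η`; the inequality and
`ν(H) = V` force `‖η‖ = 1` (`IsVariationFunctional.exists_density`). Fields supported in a ball
inside `Γ` or `Γᶜ` have no flux, so `ν` lives on the frontier. -/

set_option linter.unusedSectionVars false

namespace SkewOU

/-! ### The algebra of bounded differentiable functions -/

section Cb1

variable {H : Type*} [NormedAddCommGroup H] [InnerProductSpace ℝ H]

lemma isCb1_of_hasFDerivAt {f : H → ℝ} {f' : H → StrongDual ℝ H} {C C' : ℝ}
    (hf : ∀ z, HasFDerivAt f (f' z) z) (hC : ∀ z, |f z| ≤ C) (hC' : ∀ z, ‖f' z‖ ≤ C') :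
    IsCb1 f :=
  ⟨fun z => (hf z).differentiableAt, ⟨C, hC⟩, C', fun z => (hf z).fderiv ▸ hC' z⟩

lemma IsCb1.continuous {u : H → ℝ} (hu : IsCb1 u) : Continuous u := hu.1.continuous

lemma IsCb1.exists_bound {u : H → ℝ} (hu : IsCb1 u) : ∃ C, 0 ≤ C ∧ ∀ z, |u z| ≤ C := by
  obtain ⟨C, hC⟩ := hu.2.1
  exact ⟨C, (abs_nonneg _).trans (hC 0), hC⟩

lemma IsCb1.exists_fderiv_bound {u : H → ℝ} (hu : IsCb1 u) :
    ∃ C, 0 ≤ C ∧ ∀ z, ‖fderiv ℝ u z‖ ≤ C := by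
  obtain ⟨C, hC⟩ := hu.2.2
  exact ⟨C, (norm_nonneg _).trans (hC 0), hC⟩

lemma isCb1_const (a : ℝ) : IsCb1 (fun _ : H => a) :=
  isCb1_of_hasFDerivAt (f' := fun _ => 0) (C := |a|) (C' := 0)
    (fun z => hasFDerivAt_const a z) (fun _ => le_rfl) (fun _ => by simp)

lemma IsCb1.add {u v : H → ℝ} (hu : IsCb1 u) (hv : IsCb1 v) : IsCb1 (fun z => u z + v z) := by
  obtain ⟨C, -, hC⟩ := hu.exists_bound
  obtain ⟨D, -, hD⟩ := hv.exists_bound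
  obtain ⟨C', -, hC'⟩ := hu.exists_fderiv_bound
  obtain ⟨D', -, hD'⟩ := hv.exists_fderiv_bound
  exact isCb1_of_hasFDerivAt (fun z => (hu.1 z).hasFDerivAt.add (hv.1 z).hasFDerivAt)
    (fun z => (abs_add_le _ _).trans (add_le_add (hC z) (hD z)))
    (fun z => (norm_add_le _ _).trans (add_le_add (hC' z) (hD' z)))

lemma IsCb1.mul {u v : H → ℝ} (hu : IsCb1 u) (hv : IsCb1 v) : IsCb1 (fun z => u z * v z) := by
  obtain ⟨C, hC0, hC⟩ := hu.exists_bound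
  obtain ⟨D, hD0, hD⟩ := hv.exists_bound
  obtain ⟨C', hC0', hC'⟩ := hu.exists_fderiv_bound
  obtain ⟨D', hD0', hD'⟩ := hv.exists_fderiv_bound
  refine isCb1_of_hasFDerivAt (C := C * D) (C' := C * D' + D * C')
    (fun z => (hu.1 z).hasFDerivAt.mul (hv.1 z).hasFDerivAt)
    (fun z => ?_) (fun z => (norm_add_le _ _).trans ?_)
  · rw [abs_mul]
    exact mul_le_mul (hC z) (hD z) (abs_nonneg _) hC0
  · rw [norm_smul, norm_smul, Real.norm_eq_abs, Real.norm_eq_abs]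
    gcongr
    exacts [hC z, hD' z, hD z, hC' z]

lemma IsCb1.const_mul {u : H → ℝ} (hu : IsCb1 u) (a : ℝ) : IsCb1 (fun z => a * u z) :=
  (isCb1_const a).mul hu

lemma IsCb1.neg {u : H → ℝ} (hu : IsCb1 u) : IsCb1 (fun z => -u z) := by
  simpa using hu.const_mul (-1)

lemma IsCb1.sub {u v : H → ℝ} (hu : IsCb1 u) (hv : IsCb1 v) : IsCb1 (fun z => u z - v z) := by
  simpa [sub_eq_add_neg] using hu.add hv.neg

lemma IsCb1.sum {κ : Type*} (s : Finset κ) {u : κ → H → ℝ} (hu : ∀ i, IsCb1 (u i)) :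
    IsCb1 (fun z => ∑ i ∈ s, u i z) := by
  classical
  induction s using Finset.induction_on with
  | empty => simpa using isCb1_const (0 : ℝ)
  | insert a s ha ih => simpa [Finset.sum_insert ha] using (hu a).add ih

/-- With `u = ‖G‖²` and `a = ε²` this is a `C_b^1` majorant of `‖G‖`, which need not be
differentiable itself. The shift keeps the derivative of the root below `1 / (2√a)`. -/
lemma IsCb1.sqrt_add {u : H → ℝ} (hu : IsCb1 u) (h0 : ∀ z, 0 ≤ u z) {a : ℝ} (ha : 0 < a) :
    IsCb1 (fun z => √(u z + a)) := by
  obtain ⟨C, hC0, hC⟩ := hu.exists_bound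
  obtain ⟨C', hC0', hC'⟩ := hu.exists_fderiv_bound
  refine isCb1_of_hasFDerivAt (C := √(C + a)) (C' := 1 / (2 * √a) * C') (fun z =>
    (((hu.1 z).hasFDerivAt.add_const a).sqrt (by have := h0 z; positivity))) (fun z => ?_)
    (fun z => ?_)
  · rw [abs_of_nonneg (Real.sqrt_nonneg _)]
    exact Real.sqrt_le_sqrt (by linarith [(le_abs_self _).trans (hC z)])
  · rw [norm_smul, Real.norm_of_nonneg (by positivity)]
    gcongr
    exacts [by linarith [h0 z], hC' z]

/-- Cosines and sines of linear functionals make characteristic functions accessible to `C_b^1` test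
functions. -/
lemma isCb1_cos (h : H) : IsCb1 (fun z => Real.cos (inner ℝ z h)) := by
  refine isCb1_of_hasFDerivAt (C := 1) (C' := ‖innerSL ℝ h‖)
    (f' := fun z => -(Real.sin (inner ℝ z h) • innerSL ℝ h)) (fun z => ?_)
    (fun z => Real.abs_cos_le_one _) (fun z => ?_)
  · have := ((innerSL ℝ h).hasFDerivAt (x := z)).cos
    simp_rw [real_inner_comm h]
    exact this.congr_fderiv (by ext x; simp)
  · rw [norm_neg, norm_smul]
    exact mul_le_of_le_one_left (norm_nonneg _) (Real.abs_sin_le_one _)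

lemma isCb1_sin (h : H) : IsCb1 (fun z => Real.sin (inner ℝ z h)) := by
  refine isCb1_of_hasFDerivAt (C := 1) (C' := ‖innerSL ℝ h‖)
    (f' := fun z => Real.cos (inner ℝ z h) • innerSL ℝ h) (fun z => ?_)
    (fun z => Real.abs_sin_le_one _) (fun z => ?_)
  · have := ((innerSL ℝ h).hasFDerivAt (x := z)).sin
    simpa [real_inner_comm] using this
  · rw [norm_smul]
    exact mul_le_of_le_one_left (norm_nonneg _) (Real.abs_cos_le_one _)

variable [CompleteSpace H]

lemma inner_gradient (u : H → ℝ) (z v : H) : inner ℝ v (gradient u z) = fderiv ℝ u z v := by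
  rw [real_inner_comm, ← toDual_gradient, InnerProductSpace.toDual_apply_apply]

lemma norm_gradient (u : H → ℝ) (z : H) : ‖gradient u z‖ = ‖fderiv ℝ u z‖ := by
  rw [← toDual_gradient, LinearIsometryEquiv.norm_map]

variable [MeasurableSpace H] [BorelSpace H]

lemma measurable_gradient (u : H → ℝ) : Measurable (gradient u) :=
  (InnerProductSpace.toDual ℝ H).symm.continuous.measurable.comp (measurable_fderiv ℝ u)

lemma gradient_mul {u v : H → ℝ} (hu : Differentiable ℝ u) (hv : Differentiable ℝ v) (z : H) :
    gradient (fun z => u z * v z) z = u z • gradient v z + v z • gradient u z := by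
  refine ext_inner_left ℝ fun w => ?_
  rw [inner_gradient, inner_add_right, inner_smul_right, inner_smul_right, inner_gradient,
    inner_gradient, fderiv_fun_mul (hu z) (hv z)]
  simp

lemma IsCb1.measurable {u : H → ℝ} (hu : IsCb1 u) : Measurable u := hu.continuous.measurable

lemma IsCb1.integrable {u : H → ℝ} (hu : IsCb1 u) (ν : Measure H) [IsFiniteMeasure ν] :
    Integrable u ν := by
  obtain ⟨C, -, hC⟩ := hu.exists_bound
  exact Integrable.of_bound hu.measurable.aestronglyMeasurable C (ae_of_all _ hC)

lemma IsCb1.memLp {u : H → ℝ} (hu : IsCb1 u) (p : ℝ≥0∞) (ν : Measure H) [IsFiniteMeasure ν] :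
    MemLp u p ν := by
  obtain ⟨C, -, hC⟩ := hu.exists_bound
  exact MemLp.of_bound hu.measurable.aestronglyMeasurable C (ae_of_all _ hC)

variable [SecondCountableTopology H]

lemma IsCb1.memLp_gradient {u : H → ℝ} (hu : IsCb1 u) (p : ℝ≥0∞) (ν : Measure H)
    [IsFiniteMeasure ν] : MemLp (gradient u) p ν := by
  obtain ⟨C, -, hC⟩ := hu.exists_fderiv_bound
  exact MemLp.of_bound (measurable_gradient u).aestronglyMeasurable C
    (ae_of_all _ fun z => (norm_gradient u z).trans_le (hC z))

/-- Integration against `C_b^1(H)` determines an integrable function. -/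
lemma ae_eq_zero_of_forall_integral_mul_eq_zero {ν : Measure H} {w : H → ℝ}
    (hw : Integrable w ν) (h : ∀ u, IsCb1 u → ∫ z, w z * u z ∂ν = 0) : w =ᵐ[ν] 0 := by
  -- The positive and negative parts of `w dν` are finite measures that agree on `C_b^1`, hence have
  -- the same characteristic function and coincide. Then `w⁺ = w⁻` almost everywhere.
  have hp := hw.real_toNNReal
  have hm := hw.neg.real_toNNReal
  set p : Measure H := ν.withDensity fun z => ENNReal.ofReal (w z)
  set m : Measure H := ν.withDensity fun z => ENNReal.ofReal (-w z)
  have : IsFiniteMeasure p := isFiniteMeasure_withDensity_ofReal hw.2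
  have : IsFiniteMeasure m := isFiniteMeasure_withDensity_ofReal hw.neg.2
  have key : ∀ u, IsCb1 u → ∫ z, u z ∂p = ∫ z, u z ∂m := by
    intro u hu
    obtain ⟨C, -, hC⟩ := hu.exists_bound
    have hb := ae_of_all ν fun z => (Real.norm_eq_abs (u z)).trans_le (hC z)
    rw [integral_withDensity_eq_integral_toReal_smul₀ hw.aemeasurable.ennreal_ofReal
        (ae_of_all _ fun _ => ENNReal.ofReal_lt_top),
      integral_withDensity_eq_integral_toReal_smul₀ (f := fun z => ENNReal.ofReal (-w z))
        hw.neg.aemeasurable.ennreal_ofReal (ae_of_all _ fun _ => ENNReal.ofReal_lt_top), ← sub_eq_zero, ← integral_sub, ← h u hu]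
    · refine integral_congr_ae (ae_of_all _ fun z => ?_)
      simp only [smul_eq_mul, ENNReal.toReal_ofReal']
      rw [← sub_mul, max_zero_sub_eq_self]
    · exact hp.mul_bdd hu.measurable.aestronglyMeasurable hb
    · exact hm.mul_bdd hu.measurable.aestronglyMeasurable hb
  have hpm : p = m := by
    refine Measure.ext_of_charFun (funext fun h => ?_)
    have split : ∀ (q : Measure H) [IsFiniteMeasure q], charFun q h =
        ((∫ z, Real.cos (inner ℝ z h) ∂q : ℝ) : ℂ) +
          ((∫ z, Real.sin (inner ℝ z h) ∂q : ℝ) : ℂ) * Complex.I := by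
      intro q _
      rw [charFun_apply, ← integral_complex_ofReal, ← integral_complex_ofReal, ← integral_mul_const,
        ← integral_add ((isCb1_cos h).integrable q).ofReal
          (((isCb1_sin h).integrable q).ofReal.mul_const _)]
      refine integral_congr_ae (ae_of_all _ fun z => ?_)
      simp [Complex.exp_mul_I]
    rw [split p, split m, key _ (isCb1_cos h), key _ (isCb1_sin h)]
  have h2 := (withDensity_eq_iff hw.aemeasurable.ennreal_ofReal
    hw.neg.aemeasurable.ennreal_ofReal hw.lintegral_lt_top.ne).1 hpm
  filter_upwards [h2] with z hz
  rcases le_total (w z) 0 with h0 | h0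
  · rw [ENNReal.ofReal_of_nonpos h0] at hz
    have := ENNReal.ofReal_eq_zero.1 hz.symm
    simp at this ⊢; linarith
  · rw [show (-w) z = -w z from rfl, ENNReal.ofReal_of_nonpos (by linarith : -w z ≤ 0)] at hz
    have := ENNReal.ofReal_eq_zero.1 hz
    simp at this ⊢; linarith

end Cb1

/-! ### Gaussian integration by parts -/

section Gaussian

/-- Stein's identity for the one-dimensional centered Gaussian measure. -/
lemma integral_mul_gaussianReal {v : NNReal} (hv : v ≠ 0) {φ : ℝ → ℝ} (hφ : Differentiable ℝ φ)
    {C C' : ℝ} (hC : ∀ x, |φ x| ≤ C) (hC' : ∀ x, |deriv φ x| ≤ C') :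
    ∫ x, x * φ x ∂(gaussianReal 0 v) = v * ∫ x, deriv φ x ∂(gaussianReal 0 v) := by
  have hv' : (v : ℝ) ≠ 0 := by exact_mod_cast hv
  set p : ℝ → ℝ := gaussianPDFReal 0 v with hp
  have hpd : ∀ x, HasDerivAt p (-(x / v) * p x) x := by
    intro x
    have h1 : HasDerivAt (fun x : ℝ => -(x - 0) ^ 2 / (2 * (v : ℝ))) (-(x / v)) x := by
      have h2 := (((hasDerivAt_id x).sub_const 0).pow 2).neg.div_const (2 * (v : ℝ))
      refine h2.congr_deriv ?_
      simp
      field_simp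
    refine (h1.exp.const_mul ((√(2 * Real.pi * v))⁻¹)).congr_deriv ?_
    rw [hp, gaussianPDFReal]
    ring
  have hpi : Integrable p := integrable_gaussianPDFReal 0 v
  have hxp : Integrable fun x => x * p x := by
    have h1 : Integrable (fun x : ℝ => x) (gaussianReal 0 v) :=
      (memLp_id_gaussianReal' 1 (by simp)).integrable le_rfl
    rw [gaussianReal_of_var_ne_zero _ hv] at h1
    have h2 := (integrable_withDensity_iff_integrable_smul' (measurable_gaussianPDF 0 v)
      (ae_of_all _ fun _ => gaussianPDF_lt_top)).1 h1
    refine h2.congr (ae_of_all _ fun x => ?_)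
    simp [hp, mul_comm]
  have hφm : AEStronglyMeasurable φ volume := hφ.continuous.aestronglyMeasurable
  have hdm : AEStronglyMeasurable (deriv φ) volume := (measurable_deriv φ).aestronglyMeasurable
  have i1 : Integrable fun x => φ x * p x := hpi.bdd_mul hφm (ae_of_all _ hC)
  have i2 : Integrable fun x => deriv φ x * p x := hpi.bdd_mul hdm (ae_of_all _ hC')
  have i3 : Integrable fun x => φ x * (x * p x) := hxp.bdd_mul hφm (ae_of_all _ hC)
  have h0 := integral_eq_zero_of_hasDerivAt_of_integrable
    (f := fun x => φ x * p x) (f' := fun x => deriv φ x * p x - (v : ℝ)⁻¹ * (φ x * (x * p x)))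
    (fun x => ((hφ x).hasDerivAt.mul (hpd x)).congr_deriv (by ring)) (i2.sub (i3.const_mul _)) i1
  rw [integral_sub i2 (i3.const_mul _), integral_const_mul, sub_eq_zero] at h0
  rw [integral_gaussianReal_eq_integral_smul hv, integral_gaussianReal_eq_integral_smul hv]
  have e1 : ∫ x, p x • (x * φ x) = ∫ x, φ x * (x * p x) := by
    congr 1; ext x; simp; ring
  have e2 : ∫ x, p x • deriv φ x = ∫ x, deriv φ x * p x := by
    congr 1; ext x; simp; ring
  rw [e1, e2, h0]
  field_simp

variable {H : Type*} [NormedAddCommGroup H] [InnerProductSpace ℝ H] [CompleteSpace H]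
  [SecondCountableTopology H] [MeasurableSpace H] [BorelSpace H]

lemma memLp_inner (μ : Measure H) [IsGaussian μ] (h : H) : MemLp (fun z => inner ℝ h z) 2 μ :=
  IsGaussian.memLp_dual μ (innerSL ℝ h) 2 (by simp)

/-- The integration by parts formula for a centered Gaussian measure. -/
lemma integral_inner_mul_eq_integral_fderiv (μ : Measure H) [IsGaussian μ]
    (hmean : ∫ z, z ∂μ = 0) (h : H) {u : H → ℝ} (hu : IsCb1 u) :
    ∫ z, inner ℝ h z * u z ∂μ = ∫ z, fderiv ℝ u z (covarianceOperator μ h) ∂μ := by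
  have h2 : MemLp (id : H → H) 2 μ := IsGaussian.memLp_two_id
  have hcov : ∀ y, inner ℝ (covarianceOperator μ h) y = ∫ z, inner ℝ h z * inner ℝ y z ∂μ :=
    covarianceOperator_inner h2 h
  have hint : ∀ y : H, ∫ z, inner ℝ y z ∂μ = 0 := fun y => by
    have := IsGaussian.integral_dual (μ := μ) (innerSL ℝ y)
    simpa [hmean] using this
  set k := covarianceOperator μ h with hk
  obtain ⟨C, hC0, hC⟩ := hu.exists_bound
  obtain ⟨C', hC0', hC'⟩ := hu.exists_fderiv_bound
  have hvar : inner ℝ k h = ∫ z, (inner ℝ h z) ^ 2 ∂μ := by simp_rw [hcov, sq]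
  set s : ℝ := inner ℝ k h with hs
  have hs0 : 0 ≤ s := by rw [hvar]; exact integral_nonneg fun _ => sq_nonneg _
  -- If the variance `s` of `⟨h, ·⟩` is zero, then `⟨h, ·⟩ = 0` almost surely and `k = 0`, so both
  -- sides vanish.
  rcases hs0.eq_or_lt with hs0 | hspos
  · have hz : (fun z => inner ℝ h z) =ᵐ[μ] 0 := by
      have h3 := (integral_eq_zero_iff_of_nonneg (fun z => sq_nonneg (inner ℝ h z))
        (memLp_inner μ h).integrable_sq).1 (hvar ▸ hs0.symm)
      filter_upwards [h3] with z hz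
      simpa using hz
    have hk0 : k = 0 := by
      refine ext_inner_right ℝ fun y => ?_
      rw [hcov, inner_zero_left]
      refine integral_eq_zero_of_ae ?_
      filter_upwards [hz] with z hz
      simp [hz]
    rw [hk0]
    simp only [map_zero, integral_zero]
    refine integral_eq_zero_of_ae ?_
    filter_upwards [hz] with z hz
    simp [hz]
  -- Split `z = Y z + ξ z • (s⁻¹ • k)`. The parts are jointly Gaussian and uncorrelated, hence
  -- independent, so Fubini reduces the claim to Stein's identity in the variable `ξ` with `Y`
  -- frozen. The factor `s⁻¹` from the chain rule cancels the variance `s`.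
  · let ξ : H →L[ℝ] ℝ := innerSL ℝ h
    let Y : H →L[ℝ] H := ContinuousLinearMap.id ℝ H - ξ.smulRight (s⁻¹ • k)
    have hξY : HasGaussianLaw (fun z => (ξ z, Y z)) μ :=
      (IsGaussian.hasGaussianLaw_id (μ := μ)).map_fun (ξ.prod Y)
    have hind : IndepFun ξ Y μ := by
      refine hξY.indepFun_of_covariance_inner fun x y => ?_
      have hY : ∀ z, inner ℝ y (Y z) = inner ℝ y z - s⁻¹ * inner ℝ y k * inner ℝ h z := by
        intro z
        simp [Y, ξ, inner_sub_right, inner_smul_right]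
        ring
      have hX : ∀ z, inner ℝ x (ξ z) = x * inner ℝ h z := fun z => by simp [ξ, mul_comm]
      simp_rw [hX, hY]
      rw [covariance_const_mul_left, covariance_fun_sub_right (memLp_inner μ h) (memLp_inner μ y)
        ((memLp_inner μ h).const_mul _), covariance_const_mul_right,
        covariance_eq_sub (memLp_inner μ h) (memLp_inner μ y),
        covariance_eq_sub (memLp_inner μ h) (memLp_inner μ h)]
      simp only [hint, Pi.mul_apply]
      rw [← hcov, ← hcov, ← hs, real_inner_comm y k]
      field_simp
      ring
    have hlaw : μ.map ξ = gaussianReal 0 s.toNNReal := by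
      have h4 := (hξY.fst).map_eq_gaussianReal
      have e1 : μ[fun z => ξ z] = 0 := hint h
      have e2 : Var[fun z => ξ z; μ] = s := by
        refine (variance_eq_sub (memLp_inner μ h)).trans ?_
        rw [hint, hvar]
        simp
      rw [e1, e2] at h4
      exact h4
    have hprod : μ.map (fun z => (ξ z, Y z)) = (gaussianReal 0 s.toNNReal).prod (μ.map Y) := by
      rw [← hlaw]
      exact (indepFun_iff_map_prod_eq_prod_map_map ξ.continuous.aemeasurable
        Y.continuous.aemeasurable).1 hind
    have hrec : ∀ z, Y z + ξ z • (s⁻¹ • k) = z := fun z => by simp [Y]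
    have hYp : IsProbabilityMeasure (μ.map Y) :=
      Measure.isProbabilityMeasure_map Y.continuous.aemeasurable
    let T : ℝ × H → H := fun p => p.2 + p.1 • (s⁻¹ • k)
    have hT : Continuous T := by fun_prop
    have trans : ∀ F : ℝ → H → ℝ, Measurable (fun p : ℝ × H => F p.1 (T p)) →
        Integrable (fun z => F (ξ z) z) μ →
        ∫ z, F (ξ z) z ∂μ = ∫ y, ∫ x, F x (T (x, y)) ∂(gaussianReal 0 s.toNNReal) ∂(μ.map Y) := by
      intro F hF hFi
      have hm : Measurable fun z => (ξ z, Y z) := ξ.measurable.prodMk Y.measurable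
      have e : ∀ z, F (ξ z) z = F (ξ z) (T (ξ z, Y z)) := fun z => by simp only [T, hrec]
      have hi : Integrable (fun p : ℝ × H => F p.1 (T p)) (μ.map fun z => (ξ z, Y z)) := by
        rw [integrable_map_measure hF.aestronglyMeasurable hm.aemeasurable]
        exact hFi.congr (ae_of_all _ e)
      rw [hprod] at hi
      rw [← integral_prod_symm _ hi, ← hprod,
        integral_map hm.aemeasurable hF.aestronglyMeasurable]
      exact integral_congr_ae (ae_of_all _ e)
    have hmd : Measurable fun z => fderiv ℝ u z k := measurable_fderiv_apply_const ℝ u k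
    rw [show (∫ z, inner ℝ h z * u z ∂μ) = ∫ z, ξ z * u z ∂μ from rfl,
      trans (fun x z => x * u z) (measurable_fst.mul (hu.continuous.comp hT).measurable)
        (((memLp_inner μ h).integrable one_le_two).mul_bdd hu.measurable.aestronglyMeasurable
          (ae_of_all _ hC)),
      trans (fun x z => fderiv ℝ u z k) (hmd.comp hT.measurable)
        (Integrable.of_bound hmd.aestronglyMeasurable (C' * ‖k‖) (ae_of_all _ fun z =>
          (ContinuousLinearMap.le_opNorm _ _).trans (by gcongr; exact hC' z)))]
    refine integral_congr_ae (ae_of_all _ fun y => ?_)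
    have hder : ∀ x, HasDerivAt (fun x => u (T (x, y))) (s⁻¹ * fderiv ℝ u (T (x, y)) k) x := by
      intro x
      have h5 : HasDerivAt (fun x : ℝ => T (x, y)) (s⁻¹ • k) x := by
        exact (((hasDerivAt_id x).smul_const (s⁻¹ • k)).const_add y).congr_deriv (one_smul _ _)
      have := (hu.1 (T (x, y))).hasFDerivAt.comp_hasDerivAt x h5
      exact this.congr_deriv (by simp)
    have hd : deriv (fun x => u (T (x, y))) = fun x => s⁻¹ * fderiv ℝ u (T (x, y)) k :=
      funext fun x => (hder x).deriv
    have st := integral_mul_gaussianReal (v := s.toNNReal) (by simpa using hspos)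
      (φ := fun x => u (T (x, y))) (fun x => (hder x).differentiableAt) (C := C)
      (C' := s⁻¹ * (C' * ‖k‖)) (fun x => hC _) (fun x => by
        rw [hd, abs_mul, abs_of_pos (inv_pos.2 hspos)]
        refine mul_le_mul_of_nonneg_left ?_ (inv_pos.2 hspos).le
        exact (ContinuousLinearMap.le_opNorm _ _).trans
          (mul_le_mul_of_nonneg_right (hC' _) (norm_nonneg _)))
    simp only at st ⊢
    rw [st, hd, integral_const_mul, Real.coe_toNNReal _ hspos.le, ← mul_assoc,
      mul_inv_cancel₀ hspos.ne', one_mul]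

end Gaussian

/-! ### The adjoint of the gradient -/

section Adjoint

lemma integrable_inner_of_memLp {X E : Type*} [MeasurableSpace X] {ν : Measure X}
    [NormedAddCommGroup E] [InnerProductSpace ℝ E] {f g : X → E} (hf : MemLp f 2 ν)
    (hg : MemLp g 2 ν) : Integrable (fun x => inner ℝ (f x) (g x)) ν :=
  (hf.norm.integrable_mul hg.norm).mono' (hf.1.inner hg.1)
    (ae_of_all _ fun _ => norm_inner_le_norm _ _)

variable {H : Type*} [NormedAddCommGroup H] [InnerProductSpace ℝ H] [CompleteSpace H]
  [SecondCountableTopology H] [MeasurableSpace H] [BorelSpace H] {μ : Measure H}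

/-- Constant vector fields `l ∈ D(A)` satisfy `D^*l = 2 ⟨Al, ·⟩`. -/
def HasConstantAdjoint (μ : Measure H) (A : H →ₗ.[ℝ] H) : Prop :=
  ∀ l : A.domain, IsAdjointAt μ (fun _ => (l : H)) (fun z => 2 * inner ℝ (A l) z)

/-- Integration by parts in the dual direction `A l`: the covariance sends `A l` to `½ l`, whence
the factor 2. -/
lemma hasConstantAdjoint [IsGaussian μ] (hmean : ∫ z, z ∂μ = 0) {A : H →ₗ.[ℝ] H} {T : H →L[ℝ] H}
    (hT : IsInverse A T) (hcov : covarianceOperator μ = (1 / 2 : ℝ) • T) :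
    HasConstantAdjoint μ A := by
  refine fun l => ⟨memLp_const _, (memLp_inner μ (A l)).const_mul 2, fun u hu => ?_⟩
  have h := integral_inner_mul_eq_integral_fderiv μ hmean (A l) hu
  rw [hcov, _root_.smul_apply, hT.2 l] at h
  simp only [map_smul, smul_eq_mul, integral_const_mul] at h
  simp only [mul_assoc, integral_const_mul, inner_gradient, h]
  ring

variable [IsFiniteMeasure μ] {G G' : H → H} {w w' : H → ℝ}

lemma IsAdjointAt.integrable_mul (h : IsAdjointAt μ G w) {u : H → ℝ} (hu : IsCb1 u) :
    Integrable (fun z => w z * u z) μ :=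
  h.2.1.integrable_mul (hu.memLp 2 μ)

lemma IsAdjointAt.integrable (h : IsAdjointAt μ G w) : Integrable w μ :=
  h.2.1.integrable one_le_two

lemma IsAdjointAt.integrable_inner (h : IsAdjointAt μ G w) {u : H → ℝ} (hu : IsCb1 u) :
    Integrable (fun z => inner ℝ (G z) (gradient u z)) μ :=
  integrable_inner_of_memLp h.1 (hu.memLp_gradient 2 μ)

/-- As `adjointD` is made by choice, this uniqueness is what allows an explicit representative under
the integral. -/
lemma IsAdjointAt.ae_eq (h : IsAdjointAt μ G w) (h' : IsAdjointAt μ G w') : w =ᵐ[μ] w' := by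
  have h0 := ae_eq_zero_of_forall_integral_mul_eq_zero (ν := μ) (w := fun z => w z - w' z)
    (h.integrable.sub h'.integrable) fun u hu => by
      simp_rw [sub_mul]
      rw [integral_sub (h.integrable_mul hu) (h'.integrable_mul hu), h.2.2 u hu, h'.2.2 u hu,
        sub_self]
  filter_upwards [h0] with z hz
  exact sub_eq_zero.1 hz

lemma IsAdjointAt.adjointD (h : IsAdjointAt μ G w) : IsAdjointAt μ G (adjointD μ G) := by
  have hex : ∃ w, IsAdjointAt μ G w := ⟨w, h⟩
  rw [SkewOU.adjointD, dif_pos hex]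
  exact hex.choose_spec

lemma IsAdjointAt.adjointD_ae_eq (h : IsAdjointAt μ G w) : SkewOU.adjointD μ G =ᵐ[μ] w :=
  h.adjointD.ae_eq h

lemma IsAdjointAt.integral_eq_zero (h : IsAdjointAt μ G w) : ∫ z, w z ∂μ = 0 := by
  have h1 := h.2.2 (fun _ => 1) (isCb1_const 1)
  simp only [inner_gradient] at h1
  simpa using h1

lemma IsAdjointAt.add (h : IsAdjointAt μ G w) (h' : IsAdjointAt μ G' w') :
    IsAdjointAt μ (fun z => G z + G' z) (fun z => w z + w' z) := by
  refine ⟨h.1.add h'.1, h.2.1.add h'.2.1, fun u hu => ?_⟩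
  simp_rw [add_mul, inner_add_left]
  rw [integral_add (h.integrable_mul hu) (h'.integrable_mul hu), h.2.2 u hu, h'.2.2 u hu,
    integral_add (h.integrable_inner hu) (h'.integrable_inner hu)]

lemma isAdjointAt_zero : IsAdjointAt μ (fun _ => (0 : H)) (fun _ => 0) :=
  ⟨memLp_const _, memLp_const _, fun u _ => by simp⟩

/-- The product rule `D^*(g G) = g D^*G - ⟨G, Dg⟩`. -/
lemma IsAdjointAt.smul (h : IsAdjointAt μ G w) {g : H → ℝ} (hg : IsCb1 g) :
    IsAdjointAt μ (fun z => g z • G z)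
      (fun z => g z * w z - inner ℝ (G z) (gradient g z)) := by
  obtain ⟨C, hC0, hC⟩ := hg.exists_bound
  obtain ⟨C', hC0', hC'⟩ := hg.exists_fderiv_bound
  have m1 : MemLp (fun z => g z • G z) 2 μ :=
    (h.1.const_smul C).mono (hg.measurable.aestronglyMeasurable.smul h.1.1)
      (ae_of_all _ fun z => by
        simp only [Pi.smul_apply, norm_smul, Real.norm_eq_abs, abs_of_nonneg hC0]
        exact mul_le_mul_of_nonneg_right (hC z) (norm_nonneg _))
  have m2 : MemLp (fun z => g z * w z) 2 μ :=
    (h.2.1.const_mul C).mono (hg.measurable.aestronglyMeasurable.mul h.2.1.1)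
      (ae_of_all _ fun z => by
        simp only [norm_mul, Real.norm_eq_abs, abs_of_nonneg hC0]
        exact mul_le_mul_of_nonneg_right (hC z) (abs_nonneg _))
  have m3 : MemLp (fun z => inner ℝ (G z) (gradient g z)) 2 μ :=
    (h.1.norm.const_mul C').mono (h.1.1.inner (measurable_gradient g).aestronglyMeasurable)
      (ae_of_all _ fun z => by
        rw [norm_mul, norm_norm, Real.norm_of_nonneg hC0', mul_comm]
        refine (norm_inner_le_norm _ _).trans
          (mul_le_mul_of_nonneg_left ?_ (norm_nonneg _))
        exact (norm_gradient g z).trans_le (hC' z))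
  refine ⟨m1, m2.sub m3, fun u hu => ?_⟩
  -- Testing `G` against the product `g u` produces both terms of the product rule.
  have e := h.2.2 _ (hg.mul hu)
  have i1 : Integrable (fun z => g z * w z * u z) μ := m2.integrable_mul (hu.memLp 2 μ)
  have i2 : Integrable (fun z => inner ℝ (G z) (gradient g z) * u z) μ :=
    m3.integrable_mul (hu.memLp 2 μ)
  have i3 : Integrable (fun z => inner ℝ (g z • G z) (gradient u z)) μ :=
    integrable_inner_of_memLp m1 (hu.memLp_gradient 2 μ)
  have e1 : ∫ z, w z * (g z * u z) ∂μ = ∫ z, g z * w z * u z ∂μ := by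
    congr 1; ext z; ring
  have e2 : ∫ z, inner ℝ (G z) (gradient (fun z => g z * u z) z) ∂μ =
      ∫ z, inner ℝ (g z • G z) (gradient u z) ∂μ +
        ∫ z, inner ℝ (G z) (gradient g z) * u z ∂μ := by
    rw [← integral_add i3 i2]
    congr 1; ext z
    rw [gradient_mul hg.1 hu.1, inner_add_right, inner_smul_right, inner_smul_right,
      real_inner_smul_left, mul_comm (u z)]
  simp_rw [sub_mul]
  rw [integral_sub i1 i2, ← e1, e, e2]
  ring

end Adjoint

/-! ### Test fields -/

section TestField

variable {H : Type*} [NormedAddCommGroup H] [InnerProductSpace ℝ H] {ι : Type*}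
  {A : H →ₗ.[ℝ] H} {e : HilbertBasis ι ℝ H} {c : ι → Set.Ici (1 : ℝ)}

lemma isTestField_smul_const {g : H → ℝ} (hg : IsCb1 g) {l : H1 e c}
    (hl : H1.incl e c l ∈ A.domain) : IsTestField A e c (fun z => g z • l) :=
  ⟨1, fun _ => g, fun _ => l, fun _ => hg, fun _ => hl, fun z => by simp⟩

lemma isTestField_zero : IsTestField A e c (fun _ => 0) :=
  ⟨0, Fin.elim0, Fin.elim0, fun j => j.elim0, fun j => j.elim0, fun z => by simp⟩

lemma IsTestField.add {G G' : H → H1 e c} (h : IsTestField A e c G) (h' : IsTestField A e c G') :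
    IsTestField A e c (fun z => G z + G' z) := by
  obtain ⟨m, g, l, hg, hl, hG⟩ := h
  obtain ⟨m', g', l', hg', hl', hG'⟩ := h'
  refine ⟨m + m', Fin.append g g', Fin.append l l', fun j => ?_, fun j => ?_, fun z => ?_⟩
  · refine Fin.addCases (fun i => ?_) (fun i => ?_) j <;> simp [hg, hg']
  · refine Fin.addCases (fun i => ?_) (fun i => ?_) j <;> simp [hl, hl']
  · simp [Fin.sum_univ_add, hG, hG']

lemma IsTestField.smul {G : H → H1 e c} (h : IsTestField A e c G) {u : H → ℝ} (hu : IsCb1 u) :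
    IsTestField A e c (fun z => u z • G z) := by
  obtain ⟨m, g, l, hg, hl, hG⟩ := h
  exact ⟨m, fun j z => u z * g j z, l, fun j => hu.mul (hg j), hl, fun z => by
    simp [hG, Finset.smul_sum, mul_smul]⟩

lemma IsTestField.const_smul {G : H → H1 e c} (h : IsTestField A e c G) (a : ℝ) :
    IsTestField A e c (fun z => a • G z) := h.smul (isCb1_const a)

lemma IsTestField.induction {P : (H → H1 e c) → Prop} (h0 : P fun _ => 0)
    (hadd : ∀ (G : H → H1 e c) (g : H → ℝ) (l : H1 e c), IsTestField A e c G → IsCb1 g →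
      H1.incl e c l ∈ A.domain → P G → P fun z => G z + g z • l)
    {G : H → H1 e c} (h : IsTestField A e c G) : P G := by
  obtain ⟨m, g, l, hg, hl, hG⟩ := h
  have key : ∀ (m : ℕ) (g : Fin m → H → ℝ) (l : Fin m → H1 e c), (∀ j, IsCb1 (g j)) →
      (∀ j, H1.incl e c (l j) ∈ A.domain) → P fun z => ∑ j, g j z • l j := by
    intro m
    induction m with
    | zero => intro g l _ _; simpa using h0
    | succ m ih =>
      intro g l hg hl
      simp_rw [Fin.sum_univ_castSucc]
      exact hadd _ _ _ ⟨m, _, _, fun j => hg _, fun j => hl _, fun z => rfl⟩ (hg _) (hl _)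
        (ih _ _ (fun j => hg _) (fun j => hl _))
  rw [show G = fun z => ∑ j, g j z • l j from funext hG]
  exact key m g l hg hl

lemma IsTestField.continuous {G : H → H1 e c} (h : IsTestField A e c G) : Continuous G :=
  h.induction continuous_const
    (fun _ _ _ _ hg _ ih => ih.add (hg.continuous.smul continuous_const))

lemma IsTestField.exists_bound {G : H → H1 e c} (h : IsTestField A e c G) :
    ∃ C, 0 ≤ C ∧ ∀ z, ‖G z‖ ≤ C := by
  refine h.induction (P := fun G => ∃ C, 0 ≤ C ∧ ∀ z, ‖G z‖ ≤ C) ⟨0, le_rfl, fun _ => by simp⟩ ?_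
  rintro G g l - hg - ⟨C, hC0, hC⟩
  obtain ⟨D, hD0, hD⟩ := hg.exists_bound
  exact ⟨C + D * ‖l‖, by positivity, fun z => (norm_add_le _ _).trans (add_le_add (hC z)
    ((norm_smul _ _).trans_le (mul_le_mul_of_nonneg_right (hD z) (norm_nonneg _))))⟩

/-- The squared norm is a finite quadratic form in the coefficients `g i`, with the constant entries
`⟨l i, l j⟩`. -/
lemma IsTestField.isCb1_norm_sq {G : H → H1 e c} (h : IsTestField A e c G) :
    IsCb1 fun z => ‖G z‖ ^ 2 := by
  obtain ⟨m, g, l, hg, hl, hG⟩ := h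
  have : (fun z => ‖G z‖ ^ 2) =
      fun z => ∑ i, ∑ j, inner ℝ (l i) (l j) * (g i z * g j z) := by
    ext z
    rw [← real_inner_self_eq_norm_sq, hG, sum_inner]
    refine Finset.sum_congr rfl fun i _ => ?_
    rw [inner_sum]
    refine Finset.sum_congr rfl fun j _ => ?_
    rw [real_inner_smul_left, real_inner_smul_right]
    ring
  rw [this]
  exact IsCb1.sum _ fun i => IsCb1.sum _ fun j => ((hg i).mul (hg j)).const_mul _

variable [CompleteSpace H] [SecondCountableTopology H] [MeasurableSpace H] [BorelSpace H]
  {μ : Measure H} [IsFiniteMeasure μ]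

lemma IsTestField.isAdjointAt
    (hadj : HasConstantAdjoint μ A)
    {G : H → H1 e c} (h : IsTestField A e c G) :
    IsAdjointAt μ (fun z => H1.incl e c (G z)) (adjointD μ fun z => H1.incl e c (G z)) := by
  suffices ∃ w, IsAdjointAt μ (fun z => H1.incl e c (G z)) w from this.choose_spec.adjointD
  refine h.induction (P := fun G => ∃ w, IsAdjointAt μ (fun z => H1.incl e c (G z)) w)
    ⟨_, by simpa using isAdjointAt_zero⟩ ?_
  rintro G g l - hg hl ⟨w, hw⟩
  exact ⟨_, by simpa using hw.add ((hadj ⟨_, hl⟩).smul hg)⟩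

end TestField

/-! ### The flux of test fields through a set -/

section Flux

variable {H : Type*} [NormedAddCommGroup H] [InnerProductSpace ℝ H] [CompleteSpace H]
  [SecondCountableTopology H] [MeasurableSpace H] [BorelSpace H] {ι : Type*}
  {A : H →ₗ.[ℝ] H} {e : HilbertBasis ι ℝ H} {c : ι → Set.Ici (1 : ℝ)}
  {μ : Measure H} {Γ : Set H}

/-- The functional `G ↦ ∫_Γ D^*G dμ`. -/
noncomputable def flux (μ : Measure H) (Γ : Set H) (G : H → H1 e c) : ℝ :=
  ∫ z in Γ, adjointD μ (fun x => H1.incl e c (G x)) z ∂μ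

lemma integral_adjointD_mul_indicator (hΓ : MeasurableSet Γ) (G : H → H1 e c) :
    ∫ z, adjointD μ (fun x => H1.incl e c (G x)) z * Γ.indicator 1 z ∂μ = flux μ Γ G := by
  rw [flux, ← integral_indicator hΓ]
  congr 1; ext z
  by_cases hz : z ∈ Γ <;> simp [hz]

variable [IsFiniteMeasure μ]

lemma flux_eq_of_isAdjointAt {G : H → H1 e c} {w : H → ℝ}
    (h : IsAdjointAt μ (fun z => H1.incl e c (G z)) w) : flux μ Γ G = ∫ z in Γ, w z ∂μ :=
  integral_congr_ae (ae_restrict_of_ae h.adjointD_ae_eq)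

lemma flux_add (hadj : HasConstantAdjoint μ A) {G G' : H → H1 e c} (h : IsTestField A e c G) (h' : IsTestField A e c G') :
    flux μ Γ (fun z => G z + G' z) = flux μ Γ G + flux μ Γ G' := by
  have H := (h.isAdjointAt hadj).add (h'.isAdjointAt hadj)
  simp_rw [← map_add] at H
  rw [flux_eq_of_isAdjointAt H, integral_add (h.isAdjointAt hadj).integrable.integrableOn
    (h'.isAdjointAt hadj).integrable.integrableOn]
  rfl

lemma flux_smul (hadj : HasConstantAdjoint μ A) {G : H → H1 e c} (h : IsTestField A e c G) {u : H → ℝ} (hu : IsCb1 u) :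
    flux μ Γ (fun z => u z • G z) =
      ∫ z in Γ, (u z * adjointD μ (fun x => H1.incl e c (G x)) z -
        inner ℝ (H1.incl e c (G z)) (gradient u z)) ∂μ := by
  have H := (h.isAdjointAt hadj).smul hu
  simp_rw [← map_smul] at H
  exact flux_eq_of_isAdjointAt H

lemma flux_const_smul (hadj : HasConstantAdjoint μ A) {G : H → H1 e c} (h : IsTestField A e c G) (a : ℝ) :
    flux μ Γ (fun z => a • G z) = a * flux μ Γ G := by
  rw [flux_smul hadj h (isCb1_const a), flux, ← integral_const_mul]
  simp

end Flux

/-! ### The variation functional of a set -/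

section Variation

variable {H : Type*} [NormedAddCommGroup H] [InnerProductSpace ℝ H] [CompleteSpace H]
  [SecondCountableTopology H] [MeasurableSpace H] [BorelSpace H] {ι : Type*}
  {A : H →ₗ.[ℝ] H} {e : HilbertBasis ι ℝ H} {c : ι → Set.Ici (1 : ℝ)}
  {μ : Measure H} {Γ : Set H} {V : ℝ}

/-- `V` is the supremum of the fluxes of the test fields of norm at most one. -/
structure IsPerimeter (μ : Measure H) (A : H →ₗ.[ℝ] H) (e : HilbertBasis ι ℝ H)
    (c : ι → Set.Ici (1 : ℝ)) (Γ : Set H) (V : ℝ) : Prop where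
  flux_le : ∀ G : H → H1 e c, IsTestField A e c G → (∀ z, ‖G z‖ ≤ 1) → flux μ Γ G ≤ V
  exists_lt_flux : ∀ ε > 0, ∃ G : H → H1 e c, IsTestField A e c G ∧ (∀ z, ‖G z‖ ≤ 1) ∧
    V - ε < flux μ Γ G

/-- `Λ` extends the total variation of the flux to a positive functional on `C_b^1(H)`. -/
structure IsVariationFunctional (μ : Measure H) (A : H →ₗ.[ℝ] H) (e : HilbertBasis ι ℝ H)
    (c : ι → Set.Ici (1 : ℝ)) (Γ : Set H) (V : ℝ) (Λ : (H → ℝ) → ℝ) : Prop where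
  add : ∀ u v, IsCb1 u → IsCb1 v → Λ (fun z => u z + v z) = Λ u + Λ v
  smul : ∀ (a : ℝ) u, IsCb1 u → Λ (fun z => a * u z) = a * Λ u
  one : Λ (fun _ => 1) = V
  bound : ∀ u C, IsCb1 u → 0 ≤ C → (∀ z, |u z| ≤ C) → |Λ u| ≤ V * C
  flux_le : ∀ (G : H → H1 e c) u, IsTestField A e c G → IsCb1 u → (∀ z, ‖G z‖ ≤ u z) →
    flux μ Γ G ≤ Λ u
  vanish : ∀ u, IsCb1 u → (∀ G : H → H1 e c, IsTestField A e c G →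
    flux μ Γ (fun z => u z • G z) = 0) → Λ u = 0

variable [IsFiniteMeasure μ]

lemma flux_zero (hadj : HasConstantAdjoint μ A) : flux μ Γ (fun _ => (0 : H1 e c)) = 0 := by
  have := flux_const_smul (Γ := Γ) hadj (isTestField_zero (A := A) (e := e) (c := c)) 0
  simpa using this

/-- The zero field shows that the supremum is nonnegative, so it is neither `⊥` nor `⊤` and is a
real number. -/
lemma exists_isPerimeter (hadj : HasConstantAdjoint μ A) (hΓ : MeasurableSet Γ)
    (hfin : variationBV μ A e c (Γ.indicator 1) < ⊤) :
    ∃ V : ℝ, variationBV μ A e c (Γ.indicator 1) = (V : EReal) ∧ IsPerimeter μ A e c Γ V := by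
  have hle : ∀ G : H → H1 e c, IsTestField A e c G → (∀ z, ‖G z‖ ≤ 1) →
      ((flux μ Γ G : ℝ) : EReal) ≤ variationBV μ A e c (Γ.indicator 1) := fun G hG h1 => by
    refine le_iSup_of_le ⟨G, hG, h1⟩ ?_
    rw [integral_adjointD_mul_indicator hΓ]
  have h0 : ((0 : ℝ) : EReal) ≤ variationBV μ A e c (Γ.indicator 1) := by
    have := hle _ isTestField_zero fun z => by simp
    rwa [flux_zero hadj] at this
  have hV : ((variationBV μ A e c (Γ.indicator 1)).toReal : EReal) =
      variationBV μ A e c (Γ.indicator 1) :=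
    EReal.coe_toReal hfin.ne (ne_bot_of_le_ne_bot (EReal.coe_ne_bot 0) h0)
  refine ⟨_, hV.symm, fun G hG h1 => ?_, fun ε hε => ?_⟩
  · have := hle G hG h1
    rw [← hV] at this
    exact_mod_cast this
  · have hlt : (((variationBV μ A e c (Γ.indicator 1)).toReal - ε : ℝ) : EReal) <
        variationBV μ A e c (Γ.indicator 1) := by
      conv_rhs => rw [← hV]
      exact_mod_cast sub_lt_self _ hε
    obtain ⟨⟨G, hG, h1⟩, hlt⟩ := lt_iSup_iff.1 hlt
    rw [integral_adjointD_mul_indicator hΓ] at hlt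
    exact ⟨G, hG, h1, by exact_mod_cast hlt⟩

lemma IsPerimeter.flux_le_mul (hV : IsPerimeter μ A e c Γ V) (hadj : HasConstantAdjoint μ A)
    {G : H → H1 e c} (hG : IsTestField A e c G) {C : ℝ} (hC0 : 0 ≤ C) (hC : ∀ z, ‖G z‖ ≤ C) :
    flux μ Γ G ≤ V * C := by
  rcases hC0.eq_or_lt with rfl | hpos
  · have : G = fun _ => 0 := funext fun z => norm_le_zero_iff.1 (hC z)
    rw [this, flux_zero hadj, mul_zero]
  · have h := hV.flux_le _ (hG.const_smul C⁻¹) fun z => by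
      rw [norm_smul, Real.norm_of_nonneg (inv_nonneg.2 hC0), inv_mul_le_iff₀ hpos, mul_one]
      exact hC z
    rw [flux_const_smul hadj hG, inv_mul_le_iff₀ hpos] at h
    linarith

lemma IsPerimeter.abs_flux_le_mul (hV : IsPerimeter μ A e c Γ V) (hadj : HasConstantAdjoint μ A)
    {G : H → H1 e c} (hG : IsTestField A e c G) {C : ℝ} (hC0 : 0 ≤ C) (hC : ∀ z, ‖G z‖ ≤ C) :
    |flux μ Γ G| ≤ V * C := by
  refine abs_le'.2 ⟨hV.flux_le_mul hadj hG hC0 hC, ?_⟩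
  have := hV.flux_le_mul hadj (hG.const_smul (-1)) hC0 fun z => by
    rw [norm_smul, norm_neg, norm_one, one_mul]; exact hC z
  rwa [flux_const_smul hadj hG, neg_one_mul] at this

/-- `Λ u` is the limit of `flux (u • G n)` along a free ultrafilter, for a maximizing sequence `G
n`. The ultrafilter makes the limit exist for every `u` at once and keeps it linear. -/
lemma IsPerimeter.exists_isVariationFunctional (hV : IsPerimeter μ A e c Γ V)
    (hadj : HasConstantAdjoint μ A) : ∃ Λ, IsVariationFunctional μ A e c Γ V Λ := by
  choose G hG hG1 hGV using fun n : ℕ => hV.exists_lt_flux (1 / ((n : ℝ) + 1)) (by positivity)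
  have hlim : Tendsto (fun n => flux μ Γ (G n)) (hyperfilter ℕ) (𝓝 V) := by
    refine Tendsto.mono_left ?_ Nat.hyperfilter_le_atTop
    refine tendsto_of_tendsto_of_tendsto_of_le_of_le
      (by simpa using tendsto_one_div_add_atTop_nhds_zero_nat.const_sub V) tendsto_const_nhds
      (fun n => (hGV n).le) (fun n => hV.flux_le _ (hG n) (hG1 n))
  have hb : ∀ u C, IsCb1 u → 0 ≤ C → (∀ z, |u z| ≤ C) → ∀ n,
      |flux μ Γ (fun z => u z • G n z)| ≤ V * C := fun u C hu hC0 hC n =>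
    hV.abs_flux_le_mul hadj ((hG n).smul hu) hC0 fun z => by
      rw [norm_smul, ← mul_one C]
      exact mul_le_mul (hC z) (hG1 n z) (norm_nonneg _) hC0
  let Λ : (H → ℝ) → ℝ := fun u => limUnder (hyperfilter ℕ : Filter ℕ)
    fun n => flux μ Γ (fun z => u z • G n z)
  have hΛ : ∀ u, IsCb1 u → Tendsto (fun n => flux μ Γ (fun z => u z • G n z))
      (hyperfilter ℕ) (𝓝 (Λ u)) := by
    intro u hu
    obtain ⟨C, hC0, hC⟩ := hu.exists_bound
    obtain ⟨x, -, hx⟩ := (isCompact_Icc (a := -(V * C)) (b := V * C)).ultrafilter_le_nhds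
      ((hyperfilter ℕ).map fun n => flux μ Γ (fun z => u z • G n z))
      (by
        rw [Ultrafilter.coe_map, le_principal_iff]
        exact Filter.mem_map.2 (univ_mem' fun n => abs_le.1 (hb u C hu hC0 hC n)))
    exact tendsto_nhds_limUnder ⟨x, hx⟩
  refine ⟨Λ, ⟨fun u v hu hv => ?_, fun a u hu => ?_, ?_, fun u C hu hC0 hC => ?_,
    fun F u hF hu hFu => ?_, fun u hu h0 => ?_⟩⟩
  · refine tendsto_nhds_unique (hΛ _ (hu.add hv)) (((hΛ u hu).add (hΛ v hv)).congr fun n => ?_)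
    rw [← flux_add hadj ((hG n).smul hu) ((hG n).smul hv)]
    simp_rw [add_smul]
  · refine tendsto_nhds_unique (hΛ _ (hu.const_mul a)) (((hΛ u hu).const_mul a).congr fun n => ?_)
    rw [← flux_const_smul hadj ((hG n).smul hu)]
    simp_rw [mul_smul]
  · exact tendsto_nhds_unique (hΛ _ (isCb1_const 1)) (by simpa using hlim)
  · exact le_of_tendsto (hΛ u hu).abs (Eventually.of_forall (hb u C hu hC0 hC))
  · obtain ⟨C', hC0', hC'⟩ := hu.exists_bound
    have hC : ∀ z, u z ≤ C' + 1 := fun z => by linarith [(abs_le.1 (hC' z)).2]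
    generalize C' + 1 = C, show 0 < C' + 1 by linarith = hC0 at hC
    -- For `‖F‖ ≤ u ≤ C` the field `(1 - u / C) G n + F / C` still has norm at most one, so its flux
    -- is at most `V`. Multiplying by `C` and letting `flux (G n)` tend to `V` gives `flux F ≤ Λ u`.
    have key : ∀ n, flux μ Γ F ≤ C * (V - flux μ Γ (G n)) + flux μ Γ (fun z => u z • G n z) := by
      intro n
      have t1 := (hG n).smul hu
      have t2 := (hG n).add ((t1.const_smul (-C⁻¹)).add (hF.const_smul C⁻¹))
      have h := hV.flux_le _ t2 fun z => by
        have hu0 : 0 ≤ u z := (norm_nonneg _).trans (hFu z)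
        have e1 : G n z + (-C⁻¹ • u z • G n z + C⁻¹ • F z) =
            (1 - C⁻¹ * u z) • G n z + C⁻¹ • F z := by module
        have h1 : C⁻¹ * u z ≤ 1 := by rw [inv_mul_le_iff₀ hC0]; simpa using hC z
        rw [e1]
        refine (norm_add_le _ _).trans ?_
        rw [norm_smul, norm_smul, Real.norm_of_nonneg (by linarith),
          Real.norm_of_nonneg (inv_nonneg.2 hC0.le)]
        have h2 := mul_le_of_le_one_right (sub_nonneg.2 h1) (hG1 n z)
        have h3 := mul_le_mul_of_nonneg_left (hFu z) (inv_nonneg.2 hC0.le)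
        linarith
      rw [flux_add hadj (hG n) ((t1.const_smul _).add (hF.const_smul _)),
        flux_add hadj (t1.const_smul _) (hF.const_smul _), flux_const_smul hadj t1,
        flux_const_smul hadj hF] at h
      have h4 := mul_le_mul_of_nonneg_left h hC0.le
      have h5 : C * (flux μ Γ (G n) + (-C⁻¹ * flux μ Γ (fun z => u z • G n z) +
          C⁻¹ * flux μ Γ F)) = C * flux μ Γ (G n) - flux μ Γ (fun z => u z • G n z) +
            flux μ Γ F := by field_simp; ring
      linarith
    have hr := ((hlim.const_sub V).const_mul C).add (hΛ u hu)
    rw [sub_self, mul_zero, zero_add] at hr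
    exact ge_of_tendsto hr (Eventually.of_forall key)
  · exact tendsto_nhds_unique (hΛ u hu)
      (tendsto_const_nhds.congr fun n => (h0 (G n) (hG n)).symm)

/-- The variation functional is tight along cut-off functions. -/
lemma IsVariationFunctional.tendsto_cutoff {Λ : (H → ℝ) → ℝ}
    (hΛ : IsVariationFunctional μ A e c Γ V Λ) (hV : IsPerimeter μ A e c Γ V)
    (hadj : HasConstantAdjoint μ A) {κ : Type*} {L : Filter κ} [L.IsCountablyGenerated]
    {v : κ → H → ℝ} (hv : ∀ i, IsCb1 (v i)) (h0 : ∀ i z, 0 ≤ v i z) (h1 : ∀ i z, v i z ≤ 1)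
    {C : ℝ} (hC : ∀ i z, ‖fderiv ℝ (v i) z‖ ≤ C)
    (hlim : ∀ z, Tendsto (fun i => v i z) L (𝓝 1))
    (hlim' : ∀ z, Tendsto (fun i => fderiv ℝ (v i) z) L (𝓝 0)) :
    Tendsto (fun i => Λ (v i)) L (𝓝 V) := by
  have habs : ∀ i z, |v i z| ≤ 1 := fun i z => abs_le.2 ⟨by linarith [h0 i z], h1 i z⟩
  have hup : ∀ i, Λ (v i) ≤ V := fun i => by
    simpa using (le_abs_self _).trans (hΛ.bound (v i) 1 (hv i) zero_le_one (habs i))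
  refine tendsto_order.2 ⟨fun a ha => ?_, fun a ha => Eventually.of_forall fun i =>
    (hup i).trans_lt ha⟩
  -- One field `G` with flux above `a` suffices: `flux (v i • G)` tends to `flux G` by dominated
  -- convergence, and `‖v i • G‖ ≤ v i` bounds it by `Λ (v i)`.
  obtain ⟨G, hG, hG1, hGV⟩ := hV.exists_lt_flux (V - a) (by linarith)
  have hGadj := hG.isAdjointAt hadj
  have hconv : Tendsto (fun i => flux μ Γ (fun z => v i z • G z)) L (𝓝 (flux μ Γ G)) := by
    simp_rw [fun i => flux_smul (Γ := Γ) hadj hG (hv i), inner_gradient]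
    set w := adjointD μ fun x => H1.incl e c (G x)
    refine tendsto_integral_filter_of_dominated_convergence
      (fun z => ‖w z‖ + C * ‖H1.incl e c (G z)‖) (Eventually.of_forall fun i => ?_)
      (Eventually.of_forall fun i => ae_of_all _ fun z => ?_) ?_ (ae_of_all _ fun z => ?_)
    · have := (hGadj.smul (hv i)).integrable.aestronglyMeasurable.restrict (s := Γ)
      simpa only [inner_gradient] using this
    · refine (norm_sub_le _ _).trans (add_le_add ?_ ?_)
      · rw [norm_mul]
        exact mul_le_of_le_one_left (norm_nonneg _) (habs i z)
      · exact (ContinuousLinearMap.le_opNorm _ _).trans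
          (mul_le_mul_of_nonneg_right (hC i z) (norm_nonneg _))
    · exact (hGadj.integrable.norm.add
        ((hGadj.1.integrable one_le_two).norm.const_mul C)).integrableOn
    · have e1 := (hlim z).mul_const (w z)
      have e2 : Tendsto (fun i => fderiv ℝ (v i) z (H1.incl e c (G z))) L (𝓝 0) := by
        simpa [Function.comp_def] using ((ContinuousLinearMap.apply ℝ ℝ
          (H1.incl e c (G z))).continuous.tendsto 0).comp (hlim' z)
      simpa using e1.sub e2
  filter_upwards [(tendsto_order.1 hconv).1 a (by linarith)] with i hi
  refine hi.trans_le (hΛ.flux_le _ _ (hG.smul (hv i)) (hv i) fun z => ?_)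
  rw [norm_smul, Real.norm_of_nonneg (h0 i z)]
  exact mul_le_of_le_one_right (h0 i z) (hG1 z)

end Variation

/-! ### Cut-off functions -/

section Cutoff

variable {H : Type*} [NormedAddCommGroup H] [InnerProductSpace ℝ H]

/-- The cut-off function `z ↦ (1 + r |Q z|²)⁻¹`. -/
noncomputable def cutoff (Q : H →L[ℝ] H) (r : ℝ) (z : H) : ℝ := (1 + r * ‖Q z‖ ^ 2)⁻¹

lemma cutoff_pos (Q : H →L[ℝ] H) {r : ℝ} (hr : 0 ≤ r) (z : H) : 0 < cutoff Q r z := by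
  unfold cutoff; positivity

lemma cutoff_le_one (Q : H →L[ℝ] H) {r : ℝ} (hr : 0 ≤ r) (z : H) : cutoff Q r z ≤ 1 :=
  inv_le_one_of_one_le₀ (by have : 0 ≤ r * ‖Q z‖ ^ 2 := by positivity
                            linarith)

lemma hasFDerivAt_cutoff (Q : H →L[ℝ] H) {r : ℝ} (hr : 0 ≤ r) (z : H) :
    HasFDerivAt (cutoff Q r)
      (-((1 + r * ‖Q z‖ ^ 2) ^ 2)⁻¹ • r • (2 : ℝ) • (innerSL ℝ (Q z)).comp Q) z := by
  have h0 : 1 + r * ‖Q z‖ ^ 2 ≠ 0 := by positivity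
  have h1 : HasFDerivAt (fun z => 1 + r * ‖Q z‖ ^ 2) (r • (2 : ℝ) • (innerSL ℝ (Q z)).comp Q) z := by
    have := ((Q.hasFDerivAt (x := z)).norm_sq.const_mul r).const_add 1
    refine this.congr_fderiv ?_
    ext; simp
  exact (hasDerivAt_inv h0).comp_hasFDerivAt z h1

/-- The first bound makes the derivatives tend to zero pointwise; the second, uniform in `z`,
provides the domination. -/
lemma norm_fderiv_cutoff_le (Q : H →L[ℝ] H) (hQ : ‖Q‖ ≤ 1) {r : ℝ} (hr : 0 ≤ r) (z : H) :
    ‖fderiv ℝ (cutoff Q r) z‖ ≤ 2 * r * ‖Q z‖ ∧ ‖fderiv ℝ (cutoff Q r) z‖ ≤ 1 + r := by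
  have h0 : 1 ≤ 1 + r * ‖Q z‖ ^ 2 := by
    have : 0 ≤ r * ‖Q z‖ ^ 2 := by positivity
    linarith
  have hb : ‖fderiv ℝ (cutoff Q r) z‖ ≤ ((1 + r * ‖Q z‖ ^ 2) ^ 2)⁻¹ * (2 * r * ‖Q z‖) := by
    rw [(hasFDerivAt_cutoff Q hr z).fderiv, norm_smul, norm_neg, norm_smul, norm_smul,
      Real.norm_of_nonneg (by positivity), Real.norm_of_nonneg hr, Real.norm_of_nonneg zero_le_two]
    refine mul_le_mul_of_nonneg_left ?_ (by positivity)
    have := (ContinuousLinearMap.opNorm_comp_le (innerSL ℝ (Q z)) Q).trans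
      (mul_le_of_le_one_right (norm_nonneg _) hQ)
    rw [innerSL_apply_norm] at this
    calc _ ≤ r * (2 * ‖Q z‖) := by gcongr
      _ = _ := by ring
  refine ⟨hb.trans (mul_le_of_le_one_left (by positivity)
    (inv_le_one_of_one_le₀ (one_le_pow₀ h0))), hb.trans ?_⟩
  rw [inv_mul_le_iff₀ (by positivity)]
  have h2 : 1 + r * ‖Q z‖ ^ 2 ≤ (1 + r * ‖Q z‖ ^ 2) ^ 2 := le_self_pow₀ h0 two_ne_zero
  -- With `t = ‖Q z‖` the difference of the two sides is `1 + r (t - 1)² + r² t²`.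
  have h3 : 2 * r * ‖Q z‖ ≤ (1 + r * ‖Q z‖ ^ 2) * (1 + r) := by
    nlinarith [mul_nonneg hr (sq_nonneg (‖Q z‖ - 1)), mul_nonneg (mul_nonneg hr hr)
      (sq_nonneg ‖Q z‖)]
  exact h3.trans (mul_le_mul_of_nonneg_right h2 (by positivity))

lemma isCb1_cutoff (Q : H →L[ℝ] H) (hQ : ‖Q‖ ≤ 1) {r : ℝ} (hr : 0 ≤ r) : IsCb1 (cutoff Q r) :=
  ⟨fun z => (hasFDerivAt_cutoff Q hr z).differentiableAt,
    ⟨1, fun z => by rw [abs_of_pos (cutoff_pos Q hr z)]; exact cutoff_le_one Q hr z⟩,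
    1 + r, fun z => (norm_fderiv_cutoff_le Q hQ hr z).2⟩

lemma cutoff_tendsto_one {κ : Type*} {L : Filter κ} {Q : κ → H →L[ℝ] H} {r : κ → ℝ} {z : H}
    (h : Tendsto (fun i => r i * ‖Q i z‖ ^ 2) L (𝓝 0)) :
    Tendsto (fun i => cutoff (Q i) (r i) z) L (𝓝 1) := by
  have := (h.const_add 1).inv₀ (by simp)
  simpa [cutoff] using this

lemma fderiv_cutoff_tendsto_zero {κ : Type*} {L : Filter κ} {Q : κ → H →L[ℝ] H} {r : κ → ℝ} {z : H}
    (hQ : ∀ i, ‖Q i‖ ≤ 1) (hr : ∀ i, 0 ≤ r i)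
    (h : Tendsto (fun i => r i * ‖Q i z‖) L (𝓝 0)) :
    Tendsto (fun i => fderiv ℝ (cutoff (Q i) (r i)) z) L (𝓝 0) := by
  refine squeeze_zero_norm (fun i => (norm_fderiv_cutoff_le (Q i) (hQ i) (hr i) z).1) ?_
  simpa [mul_assoc] using h.const_mul 2

variable {ι : Type*} (e : HilbertBasis ι ℝ H)

/-- The projection onto the orthogonal complement of the span of `(eⱼ)_{j ∈ s}`. -/
noncomputable def tailProj (s : Finset ι) : H →L[ℝ] H :=
  ContinuousLinearMap.id ℝ H - ∑ j ∈ s, (innerSL ℝ (e j)).smulRight (e j)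

lemma tailProj_apply (s : Finset ι) (z : H) :
    tailProj e s z = z - ∑ j ∈ s, inner ℝ (e j) z • e j := by
  simp [tailProj]

lemma norm_tailProj_le (s : Finset ι) : ‖tailProj e s‖ ≤ 1 := by
  refine ContinuousLinearMap.opNorm_le_bound _ zero_le_one fun z => ?_
  rw [one_mul, tailProj_apply]
  set p := ∑ j ∈ s, inner ℝ (e j) z • e j
  have h : inner ℝ (z - p) p = 0 := by
    rw [inner_sub_left, inner_sum, inner_sum]
    simp_rw [inner_smul_right]
    rw [← Finset.sum_sub_distrib]
    refine Finset.sum_eq_zero fun j hj => ?_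
    rw [real_inner_comm (e j) p, e.orthonormal.inner_right_sum _ hj, real_inner_comm]
    ring
  have h2 := norm_add_sq_eq_norm_sq_add_norm_sq_of_inner_eq_zero _ _ h
  rw [sub_add_cancel] at h2
  nlinarith [norm_nonneg z, norm_nonneg (z - p), mul_self_nonneg ‖p‖]

lemma tendsto_tailProj (z : H) : Tendsto (fun s => tailProj e s z) atTop (𝓝 0) := by
  have h := (e.hasSum_repr z).const_sub z
  rw [sub_self] at h
  refine h.congr fun s => ?_
  rw [tailProj_apply]
  simp [e.repr_apply_apply]

end Cutoff

/-! ### Representation of tight positive functionals on `C_b^1(H)` by measures -/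

section Representation

/-- On the exceptional set `1 - F i ≥ 1/2` for every `i`, so by Markov's inequality its mass is at
most `2 (ν univ - ∫ F i)`, which tends to zero. -/
lemma ae_exists_half_lt {X κ : Type*} [MeasurableSpace X] {ν : Measure X} [IsFiniteMeasure ν]
    {L : Filter κ} [L.NeBot] {F : κ → X → ℝ} (hF : ∀ i, Measurable (F i))
    (h0 : ∀ i x, 0 ≤ F i x) (h1 : ∀ i x, F i x ≤ 1)
    (hlim : Tendsto (fun i => ∫ x, F i x ∂ν) L (𝓝 (ν.real univ))) :
    ∀ᵐ x ∂ν, ∃ i, 1 / 2 < F i x := by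
  have hi : ∀ i, Integrable (F i) ν := fun i =>
    Integrable.of_bound (hF i).aestronglyMeasurable 1 (ae_of_all _ fun x => by
      rw [Real.norm_of_nonneg (h0 i x)]; exact h1 i x)
  set B : Set X := {x | ¬ ∃ i, 1 / 2 < F i x}
  have hle : ∀ i, ν.real B ≤ 2 * (ν.real univ - ∫ x, F i x ∂ν) := by
    intro i
    have hm := mul_meas_ge_le_integral_of_nonneg (μ := ν) (f := fun x => 1 - F i x)
      (ae_of_all _ fun x => sub_nonneg.2 (h1 i x)) ((integrable_const 1).sub (hi i)) (1 / 2)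
    rw [integral_sub (integrable_const 1) (hi i)] at hm
    have hB : ν.real B ≤ ν.real {x | 1 / 2 ≤ 1 - F i x} := by
      refine measureReal_mono fun x hx => ?_
      have : ¬ 1 / 2 < F i x := fun h => hx ⟨i, h⟩
      change 1 / 2 ≤ 1 - F i x
      linarith
    simp only [integral_const, smul_eq_mul, mul_one] at hm
    linarith
  have hz : ν.real B ≤ 0 := by
    have ht := (hlim.const_sub (ν.real univ)).const_mul 2
    rw [sub_self, mul_zero] at ht
    exact ge_of_tendsto ht (Eventually.of_forall hle)
  rw [ae_iff]
  exact (measureReal_eq_zero_iff).1 (le_antisymm hz measureReal_nonneg)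

variable {H : Type*} [NormedAddCommGroup H] [InnerProductSpace ℝ H] [CompleteSpace H]

/-- The compactness criterion in a Hilbert space, for ultrafilters: boundedness makes each
coordinate converge, and up to a small tail a point is given by finitely many coordinates. Hence the
ultrafilter is Cauchy. -/
lemma exists_le_nhds_of_tailProj {ι : Type*} (e : HilbertBasis ι ℝ H) (𝓤 : Ultrafilter H)
    {R : ℝ} (hR : ∀ᶠ z in (𝓤 : Filter H), ‖z‖ ≤ R)
    (ht : ∀ ε > 0, ∃ s, ∀ᶠ z in (𝓤 : Filter H), ‖tailProj e s z‖ ≤ ε) : ∃ z, (𝓤 : Filter H) ≤ 𝓝 z := by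
  have hcoord : ∀ j, ∃ a, Tendsto (fun z => inner ℝ (e j) z) 𝓤 (𝓝 a) := by
    intro j
    obtain ⟨a, -, ha⟩ := (isCompact_Icc (a := -R) (b := R)).ultrafilter_le_nhds
      (𝓤.map fun z => inner ℝ (e j) z) (by
        rw [Ultrafilter.coe_map, le_principal_iff]
        refine Filter.mem_map.2 ?_
        filter_upwards [hR] with z hz
        refine abs_le.1 ((abs_real_inner_le_norm _ _).trans ?_)
        rwa [e.orthonormal.1 j, one_mul])
    exact ⟨a, ha⟩
  choose a ha using hcoord
  have hc : Cauchy (𝓤 : Filter H) := by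
    refine Metric.cauchy_iff.2 ⟨inferInstance, fun ε hε => ?_⟩
    obtain ⟨s, hs⟩ := ht (ε / 8) (by positivity)
    have hp : Tendsto (fun z => ∑ j ∈ s, inner ℝ (e j) z • e j) 𝓤 (𝓝 (∑ j ∈ s, a j • e j)) :=
      tendsto_finsetSum _ fun j _ => (ha j).smul_const _
    have hp' := Metric.tendsto_nhds.1 hp (ε / 8) (by positivity)
    refine ⟨_, hs.and hp', fun x hx y hy => ?_⟩
    obtain ⟨hx1, hx2⟩ := hx
    obtain ⟨hy1, hy2⟩ := hy
    have dec : ∀ z, z = tailProj e s z + ∑ j ∈ s, inner ℝ (e j) z • e j := fun z => by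
      rw [tailProj_apply]; abel
    rw [dec x, dec y]
    calc _ ≤ dist (tailProj e s x) (tailProj e s y) + dist _ _ := dist_add_add_le _ _ _ _
      _ ≤ (ε / 8 + ε / 8) + (ε / 8 + ε / 8) := by
        refine add_le_add ?_ ((dist_triangle_right _ _ _).trans (add_le_add hx2.le hy2.le))
        rw [dist_eq_norm]
        exact (norm_sub_le _ _).trans (add_le_add hx1 hy1)
      _ < ε := by linarith
  exact CompleteSpace.complete hc

lemma exists_continuousMap_stoneCech {X : Type*} [TopologicalSpace X] {u : X → ℝ}
    (hu : Continuous u) {C : ℝ} (hC : ∀ x, |u x| ≤ C) :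
    ∃ F : C(StoneCech X, ℝ), ∀ x, F (stoneCechUnit x) = u x := by
  have hg : Continuous fun x => (⟨u x, abs_le.1 (hC x)⟩ : Icc (-C) C) := hu.subtype_mk _
  exact ⟨⟨fun p => ((stoneCechExtend hg p : Icc (-C) C) : ℝ),
    continuous_subtype_val.comp (continuous_stoneCechExtend hg)⟩, fun x => by
      simp [stoneCechExtend_stoneCechUnit]⟩

/-- Hahn–Banach and Riesz–Markov–Kakutani: a positive functional on `C_b^1(H)` is represented by
a measure on the Stone–Čech compactification of `H`. -/
lemma exists_measure_stoneCech [MeasurableSpace (StoneCech H)] [BorelSpace (StoneCech H)]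
    {Λ : (H → ℝ) → ℝ} {V : ℝ}
    (hadd : ∀ u v, IsCb1 u → IsCb1 v → Λ (fun z => u z + v z) = Λ u + Λ v)
    (hsmul : ∀ (a : ℝ) u, IsCb1 u → Λ (fun z => a * u z) = a * Λ u)
    (hone : Λ (fun _ => 1) = V)
    (hbound : ∀ u C, IsCb1 u → 0 ≤ C → (∀ z, |u z| ≤ C) → |Λ u| ≤ V * C) :
    ∃ ν : Measure (StoneCech H), IsFiniteMeasure ν ∧
      ∀ F : C(StoneCech H, ℝ), IsCb1 (fun z => F (stoneCechUnit z)) →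
        ∫ p, F p ∂ν = Λ fun z => F (stoneCechUnit z) := by
  have hV : 0 ≤ V := by
    have := hbound _ 1 (isCb1_const 1) zero_le_one (by simp)
    linarith [abs_nonneg (Λ fun _ => 1)]
  -- The continuous functions on the compactification whose restriction to `H` is of class `C_b^1`;
  -- there `Λ` is already defined.
  let p : Submodule ℝ C(StoneCech H, ℝ) :=
    { carrier := {F | IsCb1 fun z => F (stoneCechUnit z)}
      zero_mem' := isCb1_const 0
      add_mem' := fun hF hG => IsCb1.add hF hG
      smul_mem' := fun a F hF => IsCb1.const_mul hF a }
  let f₀ : p →ₗ[ℝ] ℝ :=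
    { toFun := fun F => Λ fun z => F.1 (stoneCechUnit z)
      map_add' := fun F G => hadd _ _ F.2 G.2
      map_smul' := fun a F => hsmul a _ F.2 }
  have hf₀ : ∀ F : p, ‖f₀ F‖ ≤ V * ‖F‖ := fun F =>
    hbound _ _ F.2 (norm_nonneg _) fun z => F.1.norm_coe_le_norm _
  obtain ⟨g, hg, hgn⟩ := exists_extension_norm_eq p (f₀.mkContinuous V hf₀)
  have hgV : ‖g‖ ≤ V := hgn ▸ LinearMap.mkContinuous_norm_le _ hV hf₀
  have hg1 : g 1 = V := (hg ⟨1, isCb1_const 1⟩).trans hone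
  -- A functional of norm at most `V` with value `V` at 1 is positive: for `F ≥ 0` one has `‖‖F‖ • 1
  -- - F‖ ≤ ‖F‖`, hence `V ‖F‖ - g F ≤ V ‖F‖`.
  have hpos : ∀ F : C(StoneCech H, ℝ), (∀ x, 0 ≤ F x) → 0 ≤ g F := by
    intro F hF
    have h1 : ‖‖F‖ • (1 : C(StoneCech H, ℝ)) - F‖ ≤ ‖F‖ := by
      refine (ContinuousMap.norm_le _ (norm_nonneg _)).2 fun x => ?_
      have h2 := (le_abs_self _).trans (F.norm_coe_le_norm x)
      simp only [ContinuousMap.sub_apply, ContinuousMap.smul_apply, ContinuousMap.one_apply,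
        smul_eq_mul, mul_one]
      rw [Real.norm_of_nonneg (by linarith)]
      linarith [hF x]
    have h3 := (le_abs_self _).trans ((g.le_opNorm _).trans (mul_le_mul hgV h1 (norm_nonneg _) hV))
    rw [map_sub, map_smul, hg1, smul_eq_mul] at h3
    linarith
  let Φ : CompactlySupportedContinuousMap (StoneCech H) ℝ →ₚ[ℝ] ℝ :=
    PositiveLinearMap.mk₀
      { toFun := fun F => g F.toContinuousMap
        map_add' := fun F G => map_add g F.toContinuousMap G.toContinuousMap
        map_smul' := fun a F => map_smul g a F.toContinuousMap }
      (fun F hF => hpos _ fun x => hF x)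
  refine ⟨RealRMK.rieszMeasure Φ, inferInstance, fun F hF => ?_⟩
  have h := RealRMK.integral_rieszMeasure Φ
    ⟨F, HasCompactSupport.of_compactSpace F⟩
  exact h.trans (hg ⟨F, hF⟩)

variable [SecondCountableTopology H] [MeasurableSpace H] [BorelSpace H]

/-- A measure on the Stone–Čech compactification concentrated on `H` comes from `H`. -/
lemma exists_measure_of_stoneCech [MeasurableSpace (StoneCech H)] [BorelSpace (StoneCech H)]
    (ν : Measure (StoneCech H)) [IsFiniteMeasure ν] {S : Set (StoneCech H)} (hS : MeasurableSet S)
    (hSr : S ⊆ range (stoneCechUnit : H → StoneCech H)) (hν : ∀ᵐ p ∂ν, p ∈ S) :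
    ∃ ν' : Measure H, IsFiniteMeasure ν' ∧ ∀ (u : H → ℝ) (F : C(StoneCech H, ℝ)), Measurable u →
      (∀ z, F (stoneCechUnit z) = u z) → ∫ z, u z ∂ν' = ∫ p, F p ∂ν := by
  classical
  -- On `S` this inverts the embedding of `H`; the value 0 elsewhere concerns a null set. It is
  -- measurable because the embedding is inducing and `S` is measurable.
  let r : StoneCech H → H := fun p => if h : p ∈ S then (hSr h).choose else 0
  have hr : ∀ p ∈ S, stoneCechUnit (r p) = p := fun p hp => by
    simp only [r, dif_pos hp]
    exact (hSr hp).choose_spec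
  have hr0 : ∀ p, p ∉ S → r p = 0 := fun p hp => by simp only [r, dif_neg hp]
  have hrm : Measurable r := by
    refine measurable_of_isOpen fun B hB => ?_
    obtain ⟨B', hB', rfl⟩ := isInducing_stoneCechUnit.isOpen_iff.1 hB
    have : r ⁻¹' (stoneCechUnit ⁻¹' B') =
        (S ∩ B') ∪ (Sᶜ ∩ {p | stoneCechUnit (0 : H) ∈ B'}) := by
      ext p
      by_cases hp : p ∈ S
      · simp [hp, hr p hp]
      · simp [hp, hr0 p hp]
    rw [this]
    exact (hS.inter hB'.measurableSet).union (hS.compl.inter (MeasurableSet.const _))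
  refine ⟨ν.map r, inferInstance, fun u F hu hF => ?_⟩
  rw [integral_map hrm.aemeasurable hu.aestronglyMeasurable]
  refine integral_congr_ae ?_
  filter_upwards [hν] with p hp
  rw [← hF, hr p hp]

variable {ι : Type*} {A : H →ₗ.[ℝ] H} {e : HilbertBasis ι ℝ H} {c : ι → Set.Ici (1 : ℝ)}
  {μ : Measure H} [IsFiniteMeasure μ] {Γ : Set H} {V : ℝ}

/-- The variation functional is given by a finite measure. -/
lemma IsVariationFunctional.exists_measure [Countable ι] {Λ : (H → ℝ) → ℝ}
    (hΛ : IsVariationFunctional μ A e c Γ V Λ) (hV : IsPerimeter μ A e c Γ V)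
    (hadj : HasConstantAdjoint μ A) :
    ∃ ν : Measure H, IsFiniteMeasure ν ∧ ∀ u, IsCb1 u → ∫ z, u z ∂ν = Λ u := by
  borelize (StoneCech H)
  obtain ⟨ν, hν, hνΛ⟩ := exists_measure_stoneCech hΛ.add hΛ.smul hΛ.one hΛ.bound
  -- The condition `0 ≤ r` sits inside the existential so that `choose` gives a function of `Q` and
  -- `r` alone.
  have hext : ∀ (Q : H →L[ℝ] H) (r : ℝ), ∃ F : C(StoneCech H, ℝ), 0 ≤ r →
      (∀ z, F (stoneCechUnit z) = cutoff Q r z) ∧ (∀ p, 0 ≤ F p) ∧ ∀ p, F p ≤ 1 := by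
    intro Q r
    by_cases hr : 0 ≤ r
    · obtain ⟨F, hF⟩ := exists_continuousMap_stoneCech
        (u := cutoff Q r) (C := 1) (continuous_iff_continuousAt.2 fun z =>
          (hasFDerivAt_cutoff Q hr z).continuousAt)
        (fun z => by rw [abs_of_pos (cutoff_pos Q hr z)]; exact cutoff_le_one Q hr z)
      refine ⟨F, fun _ => ⟨hF, fun p => ?_, fun p => ?_⟩⟩
      · refine denseRange_stoneCechUnit.induction_on p (isClosed_le continuous_const F.continuous)
          fun z => ?_
        rw [hF]; exact (cutoff_pos Q hr z).le
      · refine denseRange_stoneCechUnit.induction_on p (isClosed_le F.continuous continuous_const)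
          fun z => ?_
        rw [hF]; exact cutoff_le_one Q hr z
    · exact ⟨0, fun h => absurd h hr⟩
  choose F hF using hext
  have hint : ∀ (Q : H →L[ℝ] H) (r : ℝ), ‖Q‖ ≤ 1 → 0 ≤ r → ∫ p, F Q r p ∂ν = Λ (cutoff Q r) := by
    intro Q r hQ hr
    have e1 : (fun z => F Q r (stoneCechUnit z)) = cutoff Q r := funext (hF Q r hr).1
    rw [hνΛ _ (by rw [e1]; exact isCb1_cutoff Q hQ hr), e1]
  have huniv : ν.real univ = V := by
    have := hνΛ 1 (isCb1_const 1)
    simpa [hΛ.one] using this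
  have hid : ‖ContinuousLinearMap.id ℝ H‖ ≤ 1 := ContinuousLinearMap.norm_id_le
  let rr : ℕ → ℝ := fun R => 1 / ((R : ℝ) + 1)
  have hrr : ∀ R, 0 ≤ rr R := fun R => by positivity
  have hrr1 : ∀ R, rr R ≤ 1 := fun R => by
    simp only [rr]; rw [div_le_one (by positivity)]; linarith [(Nat.cast_nonneg R : (0 : ℝ) ≤ R)]
  have hrr0 : Tendsto rr atTop (𝓝 0) := tendsto_one_div_add_atTop_nhds_zero_nat
  -- No mass escapes to infinite norm: `(1 + r |z|²)⁻¹` tends to one as `r → 0`.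
  have ae1 : ∀ᵐ p ∂ν, ∃ R : ℕ, 1 / 2 < F (ContinuousLinearMap.id ℝ H) (rr R) p := by
    refine ae_exists_half_lt (L := atTop) (fun R => (F _ _).continuous.measurable)
      (fun R => (hF _ _ (hrr R)).2.1) (fun R => (hF _ _ (hrr R)).2.2) ?_
    simp_rw [fun R => hint _ (rr R) hid (hrr R)]
    rw [huniv]
    refine hΛ.tendsto_cutoff hV hadj (C := 2) (fun R => isCb1_cutoff _ hid (hrr R))
      (fun R z => (cutoff_pos _ (hrr R) z).le) (fun R => cutoff_le_one _ (hrr R))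
      (fun R z => (norm_fderiv_cutoff_le _ hid (hrr R) z).2.trans (by linarith [hrr1 R]))
      (fun z => cutoff_tendsto_one (Q := fun _ => ContinuousLinearMap.id ℝ H) ?_)
      (fun z => fderiv_cutoff_tendsto_zero (Q := fun _ => ContinuousLinearMap.id ℝ H)
        (fun _ => hid) hrr ?_)
    · simpa using hrr0.mul_const (‖z‖ ^ 2)
    · simpa using hrr0.mul_const ‖z‖
  -- No mass escapes through the tails of the expansion: for fixed `n`, `(1 + n |Q z|²)⁻¹` with `Q`
  -- the tail projection tends to one as the finite set `s` grows.
  have ae2 : ∀ᵐ p ∂ν, ∀ n : ℕ, ∃ s : Finset ι, 1 / 2 < F (tailProj e s) n p := by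
    refine ae_all_iff.2 fun n => ?_
    have hn : (0 : ℝ) ≤ n := n.cast_nonneg
    refine ae_exists_half_lt (L := atTop) (fun s => (F _ _).continuous.measurable)
      (fun s => (hF _ _ hn).2.1) (fun s => (hF _ _ hn).2.2) ?_
    simp_rw [fun s => hint _ n (norm_tailProj_le e s) hn]
    rw [huniv]
    refine hΛ.tendsto_cutoff hV hadj (C := 1 + n)
      (fun s => isCb1_cutoff _ (norm_tailProj_le e s) hn)
      (fun s z => (cutoff_pos _ hn z).le) (fun s => cutoff_le_one _ hn)
      (fun s z => (norm_fderiv_cutoff_le _ (norm_tailProj_le e s) hn z).2)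
      (fun z => cutoff_tendsto_one ?_)
      (fun z => fderiv_cutoff_tendsto_zero (norm_tailProj_le e) (fun _ => hn) ?_)
    · simpa using ((tendsto_tailProj e z).norm.pow 2).const_mul (n : ℝ)
    · simpa using (tendsto_tailProj e z).norm.const_mul (n : ℝ)
  let S : Set (StoneCech H) := {p | (∃ R : ℕ, 1 / 2 < F (ContinuousLinearMap.id ℝ H) (rr R) p) ∧
    ∀ n : ℕ, ∃ s : Finset ι, 1 / 2 < F (tailProj e s) n p}
  -- Countability of `ι` enters here: the union over its finite subsets is countable.
  have hS : MeasurableSet S := by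
    have hm : ∀ Q r, MeasurableSet {p | 1 / 2 < F Q r p} := fun Q r =>
      measurableSet_lt measurable_const (F Q r).continuous.measurable
    have : S = (⋃ R : ℕ, {p | 1 / 2 < F (ContinuousLinearMap.id ℝ H) (rr R) p}) ∩
        ⋂ n : ℕ, ⋃ s : Finset ι, {p | 1 / 2 < F (tailProj e s) n p} := by
      ext p; simp [S]
    rw [this]
    exact (MeasurableSet.iUnion fun R => hm _ _).inter
      (MeasurableSet.iInter fun n => MeasurableSet.iUnion fun s => hm _ _)
  have hcut : ∀ {Q : H →L[ℝ] H} {r : ℝ} {z : H}, 0 ≤ r → 1 / 2 < cutoff Q r z →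
      r * ‖Q z‖ ^ 2 ≤ 1 := by
    intro Q r z hr h
    have h0 : 0 < 1 + r * ‖Q z‖ ^ 2 := by positivity
    rw [cutoff, one_div, inv_lt_inv₀ two_pos h0] at h
    linarith
  -- An ultrafilter on `H` tending to `p ∈ S` is eventually bounded with arbitrarily small tails,
  -- since the cut-offs exceed `1/2` near `p`. So it converges in `H`, and uniqueness of limits
  -- identifies `p` with the image of its limit.
  have hSr : S ⊆ range (stoneCechUnit : H → StoneCech H) := by
    rintro p ⟨⟨R, hR⟩, hp⟩
    have : (comap (stoneCechUnit : H → StoneCech H) (𝓝 p)).NeBot :=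
      isDenseInducing_stoneCechUnit.comap_nhds_neBot p
    let 𝓤 : Ultrafilter H := Ultrafilter.of (comap stoneCechUnit (𝓝 p))
    have h𝓤 : Tendsto stoneCechUnit (𝓤 : Filter H) (𝓝 p) :=
      tendsto_comap.mono_left (Ultrafilter.of_le _)
    have hev : ∀ {Q : H →L[ℝ] H} {r : ℝ}, 0 ≤ r → 1 / 2 < F Q r p →
        ∀ᶠ z in (𝓤 : Filter H), r * ‖Q z‖ ^ 2 ≤ 1 := by
      intro Q r hr h
      filter_upwards [h𝓤.eventually ((F Q r).continuous.continuousAt.eventually_const_lt h)]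
        with z hz
      rw [(hF Q r hr).1] at hz
      exact hcut hr hz
    have hb : ∀ᶠ z in (𝓤 : Filter H), ‖z‖ ≤ √((R : ℝ) + 1) := by
      filter_upwards [hev (hrr R) hR] with z hz
      refine Real.le_sqrt_of_sq_le ?_
      simp only [rr, one_div, ContinuousLinearMap.id_apply] at hz
      rwa [inv_mul_le_iff₀ (by positivity), mul_one] at hz
    obtain ⟨z, hz⟩ := exists_le_nhds_of_tailProj e 𝓤 hb fun ε hε => by
      obtain ⟨n, hn⟩ := exists_nat_gt (1 / ε ^ 2)
      obtain ⟨s, hs⟩ := hp n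
      refine ⟨s, ?_⟩
      filter_upwards [hev n.cast_nonneg hs] with z hz
      have hn0 : (0 : ℝ) < n := lt_trans (by positivity) hn
      refine abs_le_of_sq_le_sq' ?_ hε.le |>.2
      rw [div_lt_iff₀ (by positivity)] at hn
      nlinarith
    exact ⟨z, tendsto_nhds_unique ((continuous_stoneCechUnit.tendsto z).mono_left hz) h𝓤⟩
  obtain ⟨ν', hν', hνν'⟩ := exists_measure_of_stoneCech ν hS hSr (ae1.and ae2)
  refine ⟨ν', hν', fun u hu => ?_⟩
  obtain ⟨C, -, hC⟩ := hu.exists_bound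
  obtain ⟨K, hK⟩ := exists_continuousMap_stoneCech hu.continuous hC
  have e1 : (fun z => K (stoneCechUnit z)) = u := funext hK
  rw [hνν' u K hu.measurable hK, hνΛ K (by rwa [e1]), e1]

end Representation

/-! ### The Hilbert space `H₁` -/

section H1Space

variable {H : Type*} [NormedAddCommGroup H] [InnerProductSpace ℝ H] {ι : Type*}
  (e : HilbertBasis ι ℝ H) (c : ι → Set.Ici (1 : ℝ))

/-- Distinct basis vectors are at distance `√2`, so the balls of radius `1/2` around them are
disjoint open sets in a separable space. -/
lemma countable_of_hilbertBasis (e : HilbertBasis ι ℝ H) [SecondCountableTopology H] : Countable ι := by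
  have h : (univ : Set ι).Countable := by
    refine Set.PairwiseDisjoint.countable_of_isOpen (s := fun j => Metric.ball (e j) (1 / 2))
      (fun i _ j _ hij => ?_) (fun j _ => Metric.isOpen_ball)
      (fun j _ => ⟨e j, Metric.mem_ball_self (by norm_num)⟩)
    refine Metric.ball_disjoint_ball ?_
    have h2 : ‖e i - e j‖ ^ 2 = 2 := by
      rw [norm_sub_sq_real, e.orthonormal.1 i, e.orthonormal.1 j, e.orthonormal.2 hij]
      norm_num
    rw [dist_eq_norm]
    nlinarith [norm_nonneg (e i - e j)]
  exact countable_univ_iff.1 h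

lemma H1.inner_eq_tsum (x y : H1 e c) : inner ℝ x y = ∑' j, (c j : ℝ) ^ 2 *
    (inner ℝ (H1.incl e c x) (e j) * inner ℝ (H1.incl e c y) (e j)) := rfl

/-- The isometry `x ↦ (cⱼ ⟨x, eⱼ⟩)ⱼ` of `H₁` into `ℓ²`. -/
noncomputable def H1.toL2 : H1 e c →ₗᵢ[ℝ] lp (fun _ : ι => ℝ) 2 where
  toFun x := ⟨fun j => (c j : ℝ) * inner ℝ (H1.incl e c x) (e j), by
    refine memℓp_gen ?_
    simpa [mul_pow] using H1.summable_incl e c x⟩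
  map_add' x y := by
    ext j
    simp [inner_add_left, mul_add]
    rfl
  map_smul' r x := by
    ext j
    simp [real_inner_smul_left, mul_left_comm]
  norm_map' x := by
    rw [← sq_eq_sq₀ (norm_nonneg _) (norm_nonneg _), ← real_inner_self_eq_norm_sq,
      ← real_inner_self_eq_norm_sq, H1.inner_eq_tsum, lp.inner_eq_tsum]
    refine tsum_congr fun j => ?_
    simp only [real_inner_self_eq_norm_sq, Real.norm_eq_abs, sq_abs]
    change ((c j : ℝ) * inner ℝ (H1.incl e c x) (e j)) ^ 2 = _
    ring

/-- Division of coordinates by `c j ≥ 1` preserves square summability. Together with the isometry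
this transfers completeness from `ℓ²` to `H₁`. -/
lemma H1.toL2_surjective : Function.Surjective (H1.toL2 e c) := by
  intro f
  have hf : Summable fun j => (f j) ^ 2 := by
    simpa using (lp.memℓp f).summable (by norm_num)
  have hc : ∀ j, (c j : ℝ) ≠ 0 := fun j => (lt_of_lt_of_le one_pos (c j).2).ne'
  have hy : Memℓp (fun j => (c j : ℝ)⁻¹ * f j) 2 := by
    refine memℓp_gen ?_
    refine Summable.of_nonneg_of_le (fun j => by positivity) (fun j => ?_) hf
    have h1 : |(c j : ℝ)⁻¹| ≤ 1 := by
      rw [abs_of_pos (inv_pos.2 (lt_of_lt_of_le one_pos (c j).2))]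
      exact inv_le_one_of_one_le₀ (c j).2
    simp only [ENNReal.toReal_ofNat, Real.rpow_ofNat, norm_mul, Real.norm_eq_abs]
    rw [mul_pow, sq_abs (f j)]
    exact mul_le_of_le_one_left (sq_nonneg _) (pow_le_one₀ (abs_nonneg _) h1)
  let x : H := e.repr.symm ⟨_, hy⟩
  have hx : ∀ j, inner ℝ x (e j) = (c j : ℝ)⁻¹ * f j := fun j => by
    rw [real_inner_comm, ← e.repr_apply_apply]
    simp [x]
  have hmem : x ∈ h1Submodule e c := by
    refine hf.congr fun j => ?_
    rw [hx, mul_pow, ← mul_assoc, ← mul_pow, mul_inv_cancel₀ (hc j), one_pow, one_mul]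
  refine ⟨⟨x, hmem⟩, ?_⟩
  ext j
  change (c j : ℝ) * inner ℝ x (e j) = f j
  rw [hx, mul_inv_cancel_left₀ (hc j)]

instance : CompleteSpace (H1 e c) :=
  ((H1.toL2 e c).isometry.isUniformInducing.completeSpace_congr
    (H1.toL2_surjective e c)).2 inferInstance

/-- The basis vector `eⱼ` as an element of `H₁`. -/
noncomputable def H1.basisVec (j : ι) : H1 e c :=
  ⟨e j, by
    change Summable _
    refine summable_of_ne_finset_zero (s := {j}) fun i hi => ?_
    rw [Finset.mem_singleton] at hi
    rw [e.orthonormal.2 (Ne.symm hi)]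
    simp⟩

lemma H1.incl_basisVec (j : ι) : H1.incl e c (H1.basisVec e c j) = e j := rfl

/-- Against `e j` the `H₁` product is `c j ^ 2` times the product of `H`, and `c j` is nonzero. -/
lemma H1.eq_zero_of_inner_basisVec {x : H1 e c} (h : ∀ j, inner ℝ x (H1.basisVec e c j) = 0) :
    x = 0 := by
  have h2 : ∀ j, inner ℝ (H1.incl e c x) (e j) = 0 := fun j => by
    have hj := h j
    rw [H1.inner_eq_tsum, tsum_eq_single j fun i hi => by
      rw [H1.incl_basisVec, e.orthonormal.2 (Ne.symm hi)]; simp] at hj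
    have hc : (c j : ℝ) ≠ 0 := (lt_of_lt_of_le one_pos (c j).2).ne'
    rw [H1.incl_basisVec, real_inner_self_eq_norm_sq, e.orthonormal.1 j] at hj
    simpa [hc] using hj
  refine inner_self_eq_zero (𝕜 := ℝ).1 ?_
  rw [H1.inner_eq_tsum]
  simp [h2]

end H1Space

/-! ### The polar decomposition of the flux -/

section Polar

variable {H : Type*} [NormedAddCommGroup H] [InnerProductSpace ℝ H] [CompleteSpace H]
  [SecondCountableTopology H] [MeasurableSpace H] [BorelSpace H] {ι : Type*}
  {A : H →ₗ.[ℝ] H} {e : HilbertBasis ι ℝ H} {c : ι → Set.Ici (1 : ℝ)}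
  {μ : Measure H} [IsFiniteMeasure μ] {Γ : Set H} {V : ℝ} {Λ : (H → ℝ) → ℝ}
  {ν : Measure H} [IsFiniteMeasure ν]

lemma IsTestField.aestronglyMeasurable {G : H → H1 e c} (hG : IsTestField A e c G) :
    AEStronglyMeasurable G ν := hG.continuous.aestronglyMeasurable

lemma IsTestField.memLp {G : H → H1 e c} (hG : IsTestField A e c G) (p : ℝ≥0∞) :
    MemLp G p ν := by
  obtain ⟨C, -, hC⟩ := hG.exists_bound
  exact MemLp.of_bound hG.aestronglyMeasurable C (ae_of_all _ hC)

/-- The majorant `√(‖G‖² + ε²)` is of class `C_b^1` and lies below `‖G‖ + ε`; then `ε → 0`. -/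
lemma IsVariationFunctional.flux_le_integral_norm (hΛ : IsVariationFunctional μ A e c Γ V Λ)
    (hν : ∀ u, IsCb1 u → ∫ z, u z ∂ν = Λ u) {G : H → H1 e c} (hG : IsTestField A e c G) :
    flux μ Γ G ≤ ∫ z, ‖G z‖ ∂ν := by
  have hi : Integrable (fun z => ‖G z‖) ν := ((hG.memLp 1).integrable le_rfl).norm
  have key : ∀ ε : ℝ, 0 < ε → flux μ Γ G ≤ ∫ z, ‖G z‖ ∂ν + ε * ν.real univ := by
    intro ε hε
    have hcb := hG.isCb1_norm_sq.sqrt_add (fun z => sq_nonneg _) (a := ε ^ 2) (by positivity)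
    refine (hΛ.flux_le G _ hG hcb fun z => Real.le_sqrt_of_sq_le (by
      linarith [sq_nonneg ε])).trans ?_
    rw [← hν _ hcb]
    have : ∫ z, ‖G z‖ ∂ν + ε * ν.real univ = ∫ z, (‖G z‖ + ε) ∂ν := by
      rw [integral_add hi (integrable_const ε), integral_const, smul_eq_mul, mul_comm]
    rw [this]
    refine integral_mono (hcb.integrable ν) (hi.add (integrable_const ε)) fun z => ?_
    refine Real.sqrt_le_iff.2 ⟨by positivity, ?_⟩
    nlinarith [norm_nonneg (G z), mul_nonneg hε.le (norm_nonneg (G z))]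
  have ht : Tendsto (fun ε : ℝ => ∫ z, ‖G z‖ ∂ν + ε * ν.real univ) (𝓝[>] 0)
      (𝓝 (∫ z, ‖G z‖ ∂ν)) := by
    have : Tendsto (fun ε : ℝ => ∫ z, ‖G z‖ ∂ν + ε * ν.real univ) (𝓝 0)
        (𝓝 (∫ z, ‖G z‖ ∂ν + 0 * ν.real univ)) := by
      exact (continuous_const.add (continuous_id.mul continuous_const)).tendsto _
    rw [zero_mul, add_zero] at this
    exact this.mono_left nhdsWithin_le_nhds
  exact ge_of_tendsto ht (eventually_mem_nhdsWithin.mono fun ε hε => key ε hε)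

/-- Turns the `L¹` bound on the flux into `L²` continuity, where Hilbert space duality applies. -/
lemma exists_integral_norm_le (E : Type*) [NormedAddCommGroup E] (ν : Measure H)
    [IsFiniteMeasure ν] : ∃ C : NNReal, ∀ f : Lp E 2 ν, ∫ z, ‖f z‖ ∂ν ≤ C * ‖f‖ := by
  have hfin : (ν univ) ^ (1 / (1 : ℝ≥0∞).toReal - 1 / (2 : ℝ≥0∞).toReal) ≠ ⊤ :=
    ENNReal.rpow_ne_top_of_nonneg (by norm_num) (measure_ne_top _ _)
  refine ⟨((ν univ) ^ (1 / (1 : ℝ≥0∞).toReal - 1 / (2 : ℝ≥0∞).toReal)).toNNReal, fun f => ?_⟩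
  have h := eLpNorm_le_eLpNorm_mul_rpow_measure_univ (p := 1) (q := 2) one_le_two
    (Lp.aestronglyMeasurable f)
  rw [integral_norm_eq_lintegral_enorm (Lp.aestronglyMeasurable f), ← eLpNorm_one_eq_lintegral_enorm,
    Lp.norm_def, mul_comm]
  change _ ≤ _ * ENNReal.toReal _
  rw [← ENNReal.toReal_mul]
  exact ENNReal.toReal_mono (ENNReal.mul_ne_top (Lp.eLpNorm_ne_top f) hfin) h

/-- Test fields are dense in `L²(ν; H₁)`. -/
lemma dense_testField [Countable ι] (hA : ∀ j, e j ∈ A.domain)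
    {p : Submodule ℝ (Lp (H1 e c) 2 ν)}
    (hp : ∀ G : H → H1 e c, ∀ hG : IsTestField A e c G, (hG.memLp 2).toLp G ∈ p) :
    p.topologicalClosure = ⊤ := by
  rw [Submodule.topologicalClosure_eq_top_iff, Submodule.eq_bot_iff]
  intro f hf
  -- Orthogonality to `u • e j` for all `u` of class `C_b^1` makes the `j`-th coordinate vanish
  -- almost everywhere.
  have hj : ∀ j, ∀ᵐ z ∂ν, inner ℝ (f z) (H1.basisVec e c j) = 0 := by
    intro j
    refine ae_eq_zero_of_forall_integral_mul_eq_zero (w := fun z =>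
      inner ℝ (f z) (H1.basisVec e c j)) ?_ fun u hu => ?_
    · exact integrable_inner_of_memLp (Lp.memLp f) (memLp_const _)
    · have hG : IsTestField A e c fun z => u z • H1.basisVec e c j :=
        isTestField_smul_const hu (by rw [H1.incl_basisVec]; exact hA j)
      have h := (Submodule.mem_orthogonal' p f).1 hf _ (hp _ hG)
      rw [L2.inner_def] at h
      rw [← h]
      refine integral_congr_ae ?_
      filter_upwards [(hG.memLp 2 (ν := ν)).coeFn_toLp] with z hz
      rw [hz, real_inner_smul_right, mul_comm]
  rw [Lp.eq_zero_iff_ae_eq_zero]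
  filter_upwards [ae_all_iff.2 hj] with z hz
  exact H1.eq_zero_of_inner_basisVec e c hz

/-- The flux of test fields is represented by a field of norm one. -/
lemma IsVariationFunctional.exists_density [Countable ι] (hA : ∀ j, e j ∈ A.domain)
    (hadj : HasConstantAdjoint μ A) (hV : IsPerimeter μ A e c Γ V)
    (hΛ : IsVariationFunctional μ A e c Γ V Λ) (hν : ∀ u, IsCb1 u → ∫ z, u z ∂ν = Λ u) :
    ∃ η : Lp (H1 e c) 2 ν, (∀ᵐ z ∂ν, ‖η z‖ = 1) ∧
      ∀ G : H → H1 e c, IsTestField A e c G → flux μ Γ G = ∫ z, inner ℝ (η z) (G z) ∂ν := by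
  obtain ⟨C, hC⟩ := exists_integral_norm_le (H1 e c) ν
  have hle := fun {G : H → H1 e c} (hG : IsTestField A e c G) =>
    hΛ.flux_le_integral_norm hν hG
  have habs : ∀ {G : H → H1 e c}, IsTestField A e c G → |flux μ Γ G| ≤ ∫ z, ‖G z‖ ∂ν := by
    intro G hG
    refine abs_le'.2 ⟨hle hG, ?_⟩
    have := hle (hG.const_smul (-1))
    rw [flux_const_smul hadj hG] at this
    simpa using this
  -- The flux depends only on the `ν`-class of a test field, so it descends to a subspace of `L²(ν;
  -- H₁)`.
  have hcongr : ∀ {G G' : H → H1 e c}, IsTestField A e c G → IsTestField A e c G' →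
      G =ᵐ[ν] G' → flux μ Γ G = flux μ Γ G' := by
    intro G G' hG hG' h
    have h1 := habs (hG.add (hG'.const_smul (-1)))
    have h2 : ∫ z, ‖G z + (-1 : ℝ) • G' z‖ ∂ν = 0 := by
      refine integral_eq_zero_of_ae ?_
      filter_upwards [h] with z hz
      simp [hz]
    rw [h2, flux_add hadj hG (hG'.const_smul (-1)), flux_const_smul hadj hG'] at h1
    have := abs_nonpos_iff.1 h1
    linarith
  let p : Submodule ℝ (Lp (H1 e c) 2 ν) :=
    { carrier := {f | ∃ G : H → H1 e c, IsTestField A e c G ∧ f =ᵐ[ν] G}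
      zero_mem' := ⟨_, isTestField_zero, Lp.coeFn_zero _ _ _⟩
      add_mem' := by
        rintro f g ⟨F, hF, hfF⟩ ⟨G, hG, hgG⟩
        refine ⟨_, hF.add hG, ?_⟩
        filter_upwards [Lp.coeFn_add f g, hfF, hgG] with z h1 h2 h3
        rw [h1, Pi.add_apply, h2, h3]
      smul_mem' := by
        rintro a f ⟨F, hF, hfF⟩
        refine ⟨_, hF.const_smul a, ?_⟩
        filter_upwards [Lp.coeFn_smul a f, hfF] with z h1 h2
        rw [h1, Pi.smul_apply, h2] }
  choose F hF hfF using fun f : p => f.2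
  let f₀ : p →ₗ[ℝ] ℝ :=
    { toFun := fun f => flux μ Γ (F f)
      map_add' := fun f g => by
        rw [← flux_add hadj (hF f) (hF g)]
        refine hcongr (hF _) ((hF f).add (hF g)) ?_
        filter_upwards [hfF (f + g), hfF f, hfF g, Lp.coeFn_add f.1 g.1] with z h1 h2 h3 h4
        rw [← h1, ← h2, ← h3, ← Pi.add_apply, ← h4]; rfl
      map_smul' := fun a f => by
        rw [RingHom.id_apply, smul_eq_mul, ← flux_const_smul hadj (hF f)]
        refine hcongr (hF _) ((hF f).const_smul a) ?_
        filter_upwards [hfF (a • f), hfF f, Lp.coeFn_smul a f.1] with z h1 h2 h4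
        rw [← h1, ← h2, ← Pi.smul_apply, ← h4]; rfl }
  have hf₀ : ∀ f : p, ‖f₀ f‖ ≤ C * ‖f‖ := fun f => by
    refine (habs (hF f)).trans (le_trans (le_of_eq ?_) (hC f.1))
    refine integral_congr_ae ?_
    filter_upwards [hfF f] with z hz
    rw [hz]
  obtain ⟨g, hg, -⟩ := exists_extension_norm_eq p (f₀.mkContinuous C hf₀)
  let η : Lp (H1 e c) 2 ν := (InnerProductSpace.toDual ℝ _).symm g
  have hηg : ∀ f, inner ℝ η f = g f := fun f => InnerProductSpace.toDual_symm_apply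
  have hmem : ∀ G : H → H1 e c, ∀ hG : IsTestField A e c G, (hG.memLp 2).toLp G ∈ p :=
    fun G hG => ⟨G, hG, (hG.memLp 2).coeFn_toLp⟩
  have hflux : ∀ G : H → H1 e c, IsTestField A e c G →
      flux μ Γ G = ∫ z, inner ℝ (η z) (G z) ∂ν := by
    intro G hG
    have e1 : flux μ Γ G = g ((hG.memLp 2).toLp G) := by
      rw [hg ⟨_, hmem G hG⟩]
      refine hcongr hG (hF _) ?_
      filter_upwards [hfF ⟨_, hmem G hG⟩, (hG.memLp 2 (ν := ν)).coeFn_toLp] with z h1 h2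
      rw [← h1, ← h2]
    rw [e1, ← hηg, L2.inner_def]
    refine integral_congr_ae ?_
    filter_upwards [(hG.memLp 2 (ν := ν)).coeFn_toLp] with z hz
    rw [hz]
  have hcont : Continuous fun f : Lp (H1 e c) 2 ν => ∫ z, ‖f z‖ ∂ν := by
    refine (LipschitzWith.of_le_add_mul C fun f g => ?_).continuous
    have hi : ∀ f : Lp (H1 e c) 2 ν, Integrable (fun z => ‖f z‖) ν := fun f =>
      ((Lp.memLp f).integrable one_le_two).norm
    rw [dist_eq_norm]
    refine le_trans ?_ (add_le_add_right (hC (f - g)) _)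
    rw [← integral_add (hi g) (hi (f - g))]
    refine integral_mono_ae (hi f) ((hi g).add (hi _)) ?_
    filter_upwards [Lp.coeFn_sub f g] with z hz
    simp only [hz, Pi.sub_apply]
    calc ‖f z‖ = ‖g z + (f z - g z)‖ := by rw [add_sub_cancel]
      _ ≤ _ := norm_add_le _ _
  have hineq : ∀ f : Lp (H1 e c) 2 ν, inner ℝ η f ≤ ∫ z, ‖f z‖ ∂ν := by
    intro f
    have hcl : IsClosed {f : Lp (H1 e c) 2 ν | inner ℝ η f ≤ ∫ z, ‖f z‖ ∂ν} :=
      isClosed_le (continuous_const.inner continuous_id) hcont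
    have hd : f ∈ closure (p : Set (Lp (H1 e c) 2 ν)) := by
      rw [← Submodule.topologicalClosure_coe, dense_testField hA hmem]
      trivial
    refine closure_minimal (fun f hf => ?_) hcl hd
    change inner ℝ η f ≤ _
    rw [hηg, hg ⟨f, hf⟩]
    refine (hle (hF ⟨f, hf⟩)).trans (le_of_eq (integral_congr_ae ?_))
    filter_upwards [hfF ⟨f, hf⟩] with z hz
    rw [← hz]
  have hηm : StronglyMeasurable η := Lp.stronglyMeasurable η
  -- Testing with `η` restricted to `B = {‖η‖ > 1}` gives `∫_B ‖η‖² ≤ ∫_B ‖η‖`, so `B` is a null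
  -- set.
  have hle1 : ∀ᵐ z ∂ν, ‖η z‖ ≤ 1 := by
    let B : Set H := {z | 1 < ‖η z‖}
    have hB : MeasurableSet B := measurableSet_lt measurable_const hηm.norm.measurable
    have hm := (Lp.memLp η).indicator hB
    have h1 := hineq (hm.toLp _)
    rw [L2.inner_def] at h1
    have i1 : Integrable (fun z => B.indicator (fun z => ‖η z‖ ^ 2) z) ν :=
      ((Lp.memLp η).norm.integrable_sq).indicator hB
    have i2 : Integrable (fun z => B.indicator (fun z => ‖η z‖) z) ν :=
      (((Lp.memLp η).integrable one_le_two).norm).indicator hB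
    have e1 : ∫ z, inner ℝ (η z) (hm.toLp _ z) ∂ν = ∫ z, B.indicator (fun z => ‖η z‖ ^ 2) z ∂ν := by
      refine integral_congr_ae ?_
      filter_upwards [hm.coeFn_toLp] with z hz
      rw [hz]
      by_cases hzB : z ∈ B <;> simp [hzB]
    have e2 : ∫ z, ‖hm.toLp _ z‖ ∂ν = ∫ z, B.indicator (fun z => ‖η z‖) z ∂ν := by
      refine integral_congr_ae ?_
      filter_upwards [hm.coeFn_toLp] with z hz
      rw [hz]
      by_cases hzB : z ∈ B <;> simp [hzB]
    rw [e1, e2, ← sub_nonpos, ← integral_sub i1 i2] at h1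
    have hnn : ∀ z, 0 ≤ B.indicator (fun z => ‖η z‖ ^ 2) z - B.indicator (fun z => ‖η z‖) z := by
      intro z
      by_cases hzB : z ∈ B
      · have : 1 < ‖η z‖ := hzB
        simp only [hzB, indicator_of_mem]
        nlinarith
      · simp [hzB]
    have h2 := (integral_eq_zero_iff_of_nonneg hnn (i1.sub i2)).1
      (le_antisymm h1 (integral_nonneg hnn))
    filter_upwards [h2] with z hz
    by_contra hzB
    have hzB' : z ∈ B := not_le.1 hzB
    have : 1 < ‖η z‖ := hzB'
    simp only [hzB', indicator_of_mem, Pi.zero_apply] at hz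
    nlinarith
  refine ⟨η, ?_, hflux⟩
  have i0 : Integrable (fun z => ‖η z‖) ν := ((Lp.memLp η).integrable one_le_two).norm
  have huniv : ν.real univ = V := by
    have := hν _ (isCb1_const 1)
    simpa [hΛ.one] using this
  -- Nearly maximizing fields give `V ≤ ∫ ‖η‖ dν`; as `ν(H) = V` and `‖η‖ ≤ 1`, equality holds
  -- almost everywhere.
  have hVle : V ≤ ∫ z, ‖η z‖ ∂ν := by
    refine le_of_forall_pos_le_add fun ε hε => ?_
    obtain ⟨G, hG, hG1, hGV⟩ := hV.exists_lt_flux ε hε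
    have : flux μ Γ G ≤ ∫ z, ‖η z‖ ∂ν := by
      rw [hflux G hG]
      refine integral_mono (integrable_inner_of_memLp (Lp.memLp η) (hG.memLp 2)) i0 fun z => ?_
      exact (real_inner_le_norm _ _).trans (mul_le_of_le_one_right (norm_nonneg _) (hG1 z))
    linarith
  have hnn : 0 ≤ᵐ[ν] fun z => 1 - ‖η z‖ := by
    filter_upwards [hle1] with z hz
    simpa using hz
  have h0 : ∫ z, (1 - ‖η z‖) ∂ν = 0 := by
    refine le_antisymm ?_ (integral_nonneg_of_ae hnn)
    rw [integral_sub (integrable_const 1) i0, integral_const, huniv]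
    simpa using hVle
  filter_upwards [(integral_eq_zero_iff_of_nonneg_ae hnn ((integrable_const 1).sub i0)).1 h0]
    with z hz
  simp only [Pi.zero_apply] at hz
  linarith

end Polar

/-! ### Surface measures and normals -/

section Bump

variable {H : Type*} [NormedAddCommGroup H] [InnerProductSpace ℝ H]

/-- At the kink of `max t 0` the square is `O(t²)`, so its derivative is zero there. -/
lemma hasDerivAt_sq_max_zero (t : ℝ) : HasDerivAt (fun t : ℝ => max t 0 ^ 2) (2 * max t 0) t := by
  rcases lt_trichotomy t 0 with h | rfl | h
  · rw [max_eq_right h.le, mul_zero]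
    refine (hasDerivAt_const t (0 : ℝ)).congr_of_eventuallyEq ?_
    filter_upwards [gt_mem_nhds h] with s hs
    simp [max_eq_right (le_of_lt hs)]
  · rw [max_self, mul_zero]
    have hO : (fun t : ℝ => max t 0 ^ 2) =O[𝓝 0] fun x => ‖x - 0‖ ^ 2 := by
      refine Asymptotics.IsBigO.of_bound 1 (Eventually.of_forall fun t => ?_)
      rw [one_mul, norm_pow, norm_pow, norm_norm, sub_zero, Real.norm_eq_abs, Real.norm_eq_abs]
      refine pow_le_pow_left₀ (abs_nonneg _) ?_ 2
      rw [abs_of_nonneg (le_max_right t 0)]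
      exact max_le (le_abs_self t) (abs_nonneg t)
    exact (hO.hasFDerivAt one_lt_two).hasDerivAt
  · rw [max_eq_left h.le]
    have : HasDerivAt (fun t : ℝ => t ^ 2) (2 * t) t := by simpa using hasDerivAt_pow 2 t
    refine this.congr_of_eventuallyEq ?_
    filter_upwards [lt_mem_nhds h] with s hs
    rw [max_eq_left (le_of_lt hs)]

/-- A bump function of class `C_b^1` that is positive exactly on the ball `B(a, r)`. -/
noncomputable def ballBump (a : H) (r : ℝ) (z : H) : ℝ := max (r ^ 2 - ‖z - a‖ ^ 2) 0 ^ 2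

lemma hasFDerivAt_ballBump (a : H) (r : ℝ) (z : H) :
    HasFDerivAt (ballBump a r)
      ((2 * max (r ^ 2 - ‖z - a‖ ^ 2) 0) • -((2 : ℝ) • innerSL ℝ (z - a))) z := by
  have h1 : HasFDerivAt (fun z => r ^ 2 - ‖z - a‖ ^ 2) (-((2 : ℝ) • innerSL ℝ (z - a))) z := by
    have := (((hasFDerivAt_id z).sub_const a).norm_sq).const_sub (r ^ 2)
    refine this.congr_fderiv ?_
    ext; simp
  exact (hasDerivAt_sq_max_zero _).comp_hasFDerivAt z h1

lemma max_sub_sq_le (a z : H) (r : ℝ) : max (r ^ 2 - ‖z - a‖ ^ 2) 0 ≤ r ^ 2 :=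
  max_le (by linarith [sq_nonneg ‖z - a‖]) (sq_nonneg r)

lemma max_sub_sq_eq_zero {a z : H} {r : ℝ} (hr : 0 ≤ r) (hz : z ∉ Metric.ball a r) :
    max (r ^ 2 - ‖z - a‖ ^ 2) 0 = 0 := by
  rw [Metric.mem_ball, dist_eq_norm, not_lt] at hz
  exact max_eq_right (by nlinarith)

lemma isCb1_ballBump (a : H) {r : ℝ} (hr : 0 ≤ r) : IsCb1 (ballBump a r) := by
  refine isCb1_of_hasFDerivAt (C := (r ^ 2) ^ 2) (C' := 2 * r ^ 2 * (2 * r))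
    (hasFDerivAt_ballBump a r) (fun z => ?_) (fun z => ?_)
  · rw [ballBump, abs_of_nonneg (sq_nonneg _)]
    exact pow_le_pow_left₀ (le_max_right _ _) (max_sub_sq_le a z r) 2
  · by_cases hz : z ∈ Metric.ball a r
    · rw [norm_smul, norm_neg, norm_smul, innerSL_apply_norm, Real.norm_of_nonneg zero_le_two,
        Real.norm_of_nonneg (mul_nonneg zero_le_two (le_max_right _ _))]
      rw [Metric.mem_ball, dist_eq_norm] at hz
      have := max_sub_sq_le a z r
      gcongr
    · rw [max_sub_sq_eq_zero hr hz, mul_zero, zero_smul, norm_zero]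
      positivity

lemma ballBump_eq_zero {a z : H} {r : ℝ} (hr : 0 ≤ r) (hz : z ∉ Metric.ball a r) :
    ballBump a r z = 0 := by
  simp [ballBump, max_sub_sq_eq_zero hr hz]

lemma fderiv_ballBump_eq_zero {a z : H} {r : ℝ} (hr : 0 ≤ r) (hz : z ∉ Metric.ball a r) :
    fderiv ℝ (ballBump a r) z = 0 := by
  rw [(hasFDerivAt_ballBump a r z).fderiv, max_sub_sq_eq_zero hr hz, mul_zero, zero_smul]

lemma ballBump_pos {a z : H} {r : ℝ} (hz : z ∈ Metric.ball a r) : 0 < ballBump a r z := by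
  rw [Metric.mem_ball, dist_eq_norm] at hz
  have h : 0 < r ^ 2 - ‖z - a‖ ^ 2 := by nlinarith [norm_nonneg (z - a)]
  rw [ballBump, max_eq_left h.le]
  positivity

end Bump

/-! ### Support of the surface measure and existence of the pair -/

section Surface

variable {H : Type*} [NormedAddCommGroup H] [InnerProductSpace ℝ H] [CompleteSpace H]
  [SecondCountableTopology H] [MeasurableSpace H] [BorelSpace H] {ι : Type*}
  {A : H →ₗ.[ℝ] H} {e : HilbertBasis ι ℝ H} {c : ι → Set.Ici (1 : ℝ)}
  {μ : Measure H} [IsFiniteMeasure μ] {Γ : Set H} {V : ℝ} {Λ : (H → ℝ) → ℝ}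
  {ν : Measure H} [IsFiniteMeasure ν]

/-- A field vanishing off a ball inside or outside `Γ` has flux zero. -/
lemma flux_ballBump_eq_zero (hadj : HasConstantAdjoint μ A) {a : H} {r : ℝ} (hr : 0 ≤ r)
    (h : Metric.ball a r ⊆ Γ ∨ Metric.ball a r ⊆ Γᶜ) {G : H → H1 e c} (hG : IsTestField A e c G) :
    flux μ Γ (fun z => ballBump a r z • G z) = 0 := by
  have hb := isCb1_ballBump a hr
  have hz : ∀ z, z ∉ Metric.ball a r →
      ballBump a r z * adjointD μ (fun x => H1.incl e c (G x)) z -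
        inner ℝ (H1.incl e c (G z)) (gradient (ballBump a r) z) = 0 := fun z hz => by
    rw [inner_gradient, fderiv_ballBump_eq_zero hr hz, ballBump_eq_zero hr hz]
    simp
  rw [flux_smul hadj hG hb]
  -- For a ball inside `Γ` the integral over `Γ` equals that over `H`, and a divergence has mean
  -- zero; for a ball outside, the integrand vanishes on `Γ`.
  rcases h with h | h
  · rw [setIntegral_eq_integral_of_forall_compl_eq_zero fun z hzΓ => hz z fun hzb => hzΓ (h hzb)]
    exact ((hG.isAdjointAt hadj).smul hb).integral_eq_zero
  · exact setIntegral_eq_zero_of_forall_eq_zero fun z hzΓ => hz z fun hzb => h hzb hzΓ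

/-- On each small ball in `U` a bump function, positive exactly there, has `Λ`-value zero. In a
separable space locally null sets are null. -/
lemma IsVariationFunctional.measure_eq_zero_of_isOpen (hadj : HasConstantAdjoint μ A)
    (hΛ : IsVariationFunctional μ A e c Γ V Λ) (hν : ∀ u, IsCb1 u → ∫ z, u z ∂ν = Λ u)
    {U : Set H} (hU : IsOpen U) (h : U ⊆ Γ ∨ U ⊆ Γᶜ) : ν U = 0 := by
  refine measure_null_of_locally_null U fun a ha => ?_
  obtain ⟨r, hr, hball⟩ := Metric.isOpen_iff.1 hU a ha
  refine ⟨Metric.ball a r, mem_nhdsWithin_of_mem_nhds (Metric.ball_mem_nhds a hr), ?_⟩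
  have hb := isCb1_ballBump a hr.le
  have h0 : ∫ z, ballBump a r z ∂ν = 0 := by
    rw [hν _ hb]
    exact hΛ.vanish _ hb fun G hG =>
      flux_ballBump_eq_zero hadj hr.le (h.imp hball.trans hball.trans) hG
  have h1 := (integral_eq_zero_iff_of_nonneg (fun z => sq_nonneg _) (hb.integrable ν)).1 h0
  refine measure_mono_null (fun z hz => ?_) (ae_iff.1 h1)
  exact (ballBump_pos hz).ne'

/-- The surface measure and the exterior normal exist. -/
theorem exists_isSurfacePair (hA : ∀ j, e j ∈ A.domain)
    (hadj : HasConstantAdjoint μ A) (hΓ : IsClosed Γ)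
    (hfin : variationBV μ A e c (Γ.indicator 1) < ⊤) :
    ∃ p : Measure H × (H → StrongDual ℝ (H1 e c)), IsSurfacePair μ A e c Γ p.1 p.2 := by
  have : Countable ι := countable_of_hilbertBasis e
  obtain ⟨V, hVeq, hV⟩ := exists_isPerimeter hadj hΓ.measurableSet hfin
  obtain ⟨Λ, hΛ⟩ := hV.exists_isVariationFunctional hadj
  obtain ⟨ν, hνfin, hν⟩ := hΛ.exists_measure hV hadj
  obtain ⟨η, hη1, hη⟩ := hΛ.exists_density hA hadj hV hν
  have hc : ν Γᶜ = 0 :=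
    hΛ.measure_eq_zero_of_isOpen hadj hν hΓ.isOpen_compl (Or.inr Subset.rfl)
  have hi : ν (interior Γ) = 0 :=
    hΛ.measure_eq_zero_of_isOpen hadj hν isOpen_interior (Or.inl interior_subset)
  have hf : ν (frontier Γ)ᶜ = 0 := by
    refine measure_mono_null (fun z hz => ?_) (measure_union_null hi hc)
    rw [hΓ.frontier_eq, mem_compl_iff, Set.mem_sdiff, not_and_not_right] at hz
    by_cases h : z ∈ Γ
    · exact Or.inl (hz h)
    · exact Or.inr h
  have huniv : ν.real univ = V := by
    have := hν _ (isCb1_const 1)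
    simpa [hΛ.one] using this
  have hηm : StronglyMeasurable η := Lp.stronglyMeasurable η
  -- The normal is `-η`: the Gauss formula carries a minus sign, the density of the flux does not.
  refine ⟨(ν, fun z => InnerProductSpace.toDual ℝ (H1 e c) (-η z)), ⟨hνfin, hc, hf, ?_, ?_, ?_,
    fun G hG => ?_⟩⟩
  · exact ((InnerProductSpace.toDual ℝ (H1 e c)).continuous.comp_stronglyMeasurable
      hηm.neg).measurable
  · refine ae_restrict_of_ae ?_
    filter_upwards [hη1] with z hz
    exact ((InnerProductSpace.toDual ℝ (H1 e c)).norm_map _).trans ((norm_neg _).trans hz)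
  · have e1 : ν Γ = ν univ := by
      rw [← measure_add_measure_compl hΓ.measurableSet, hc, add_zero]
    have e2 : ν univ = ENNReal.ofReal V := by
      rw [← huniv, ofReal_measureReal]
    simp only [e1, e2, hVeq, EReal.coe_ennreal_ofReal]
    rw [max_eq_left]
    rw [← huniv]; exact measureReal_nonneg
  · have e1 : ν.restrict (frontier Γ) = ν :=
      Measure.restrict_eq_self_of_ae_mem (by rw [ae_iff]; exact hf)
    simp only [e1]
    change flux μ Γ G = _
    rw [hη G hG, ← integral_neg]
    simp [InnerProductSpace.toDual_apply_apply]

end Surface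

/-! ### The step density -/

section StepDensity

variable {X : Type*} {Γ : ℤ → Set X} {γ : ℤ → ℝ}

/-- Hence at each point the series `stepDensity` has at most one nonzero term. -/
lemma eq_of_mem_sdiff (hΓ : Monotone Γ) {z : X} {k m : ℤ} (hk : z ∈ Γ (k + 1) \ Γ k)
    (hm : z ∈ Γ (m + 1) \ Γ m) : k = m := by
  rcases lt_trichotomy k m with h | h | h
  · exact absurd (hΓ (show k + 1 ≤ m by omega) hk.1) hm.2
  · exact h
  · exact absurd (hΓ (show m + 1 ≤ k by omega) hm.1) hk.2

lemma hasSum_stepDensity (hΓ : Monotone Γ) (γ : ℤ → ℝ) (z : X) :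
    HasSum (fun k : ℤ => (Γ (k + 1) \ Γ k).indicator (fun _ => γ (k + 1)) z)
      (stepDensity Γ γ z) := by
  refine Summable.hasSum ?_
  by_cases h : ∃ k, z ∈ Γ (k + 1) \ Γ k
  · obtain ⟨k, hk⟩ := h
    refine summable_of_ne_finset_zero (s := {k}) fun m hm => indicator_of_notMem (fun h => hm ?_) _
    rw [Finset.mem_singleton]
    exact eq_of_mem_sdiff hΓ h hk
  · push Not at h
    refine summable_of_ne_finset_zero (s := ∅) fun m _ => indicator_of_notMem (h m) _

lemma stepDensity_eq (hΓ : Monotone Γ) (γ : ℤ → ℝ) {z : X} {k : ℤ} (hk : z ∈ Γ (k + 1) \ Γ k) :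
    stepDensity Γ γ z = γ (k + 1) := by
  rw [stepDensity, tsum_eq_single k fun m hm => indicator_of_notMem (fun h => hm ?_) _,
    indicator_of_mem hk]
  exact eq_of_mem_sdiff hΓ h hk

lemma stepDensity_eq_zero_or (hΓ : Monotone Γ) (γ : ℤ → ℝ) (z : X) :
    stepDensity Γ γ z = 0 ∨ ∃ k, stepDensity Γ γ z = γ k := by
  by_cases h : ∃ k, z ∈ Γ (k + 1) \ Γ k
  · obtain ⟨k, hk⟩ := h
    exact Or.inr ⟨_, stepDensity_eq hΓ γ hk⟩
  · push Not at h
    left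
    rw [stepDensity, tsum_congr fun m => indicator_of_notMem (h m) _, tsum_zero]

variable [MeasurableSpace X] {μ : Measure X}

lemma measurable_stepDensity (hΓ : Monotone Γ) (hm : ∀ k, MeasurableSet (Γ k)) :
    Measurable (stepDensity Γ γ) := by
  refine measurable_of_tendsto_metrizable' (u := (atTop : Filter (Finset ℤ)))
    (f := fun s z => ∑ k ∈ s, (Γ (k + 1) \ Γ k).indicator (fun _ => γ (k + 1)) z)
    (fun s => Finset.measurable_sum _ fun k _ =>
      measurable_const.indicator ((hm _).diff (hm _)))
    (tendsto_pi_nhds.2 fun z => hasSum_stepDensity hΓ γ z)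

lemma ae_exists_mem_sdiff [IsFiniteMeasure μ] (hΓ : Monotone Γ) (hm : ∀ k, MeasurableSet (Γ k))
    (hbot : Tendsto (fun k => μ (Γ k)) atBot (𝓝 0))
    (htop : Tendsto (fun k => μ (Γ k)) atTop (𝓝 (μ univ))) :
    ∀ᵐ z ∂μ, ∃ k : ℤ, z ∈ Γ (k + 1) \ Γ k := by
  have h1 : ∀ᵐ z ∂μ, ∃ k, z ∉ Γ k := by
    rw [ae_iff]
    have hle : ∀ k, μ {z | ¬ ∃ k, z ∉ Γ k} ≤ μ (Γ k) := fun k => measure_mono fun z hz => by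
      by_contra h
      exact hz ⟨k, h⟩
    exact le_antisymm (ge_of_tendsto hbot (Eventually.of_forall hle)) zero_le
  have h2 : ∀ᵐ z ∂μ, ∃ k, z ∈ Γ k := by
    have hu : μ (⋃ k, Γ k) = μ univ :=
      tendsto_nhds_unique (tendsto_measure_iUnion_atTop hΓ) htop
    have h0 : μ (⋃ k, Γ k)ᶜ = 0 := by
      rw [measure_compl (MeasurableSet.iUnion hm) (measure_ne_top _ _), hu, tsub_self]
    filter_upwards [measure_eq_zero_iff_ae_notMem.1 h0] with z hz
    simpa using hz
  filter_upwards [h1, h2] with z ⟨a, ha⟩ ⟨b, hb⟩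
  -- If `k` is the least index with `z ∈ Γ k`, then `z` lies in the ring with index `k - 1`.
  obtain ⟨k, hk, hmin⟩ := Int.exists_least_of_bdd (P := fun k => z ∈ Γ k)
    ⟨a, fun k hk => not_lt.1 fun hka => ha (hΓ hka.le hk)⟩ ⟨b, hb⟩
  refine ⟨k - 1, by simpa using hk, fun h => ?_⟩
  have := hmin _ h
  omega

end StepDensity

/-! ### The closure of the form -/

section ClosedForm

variable {H : Type*} [NormedAddCommGroup H] [InnerProductSpace ℝ H] [CompleteSpace H]
  [SecondCountableTopology H] [MeasurableSpace H] [BorelSpace H]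
  {μ : Measure H} [IsFiniteMeasure μ] {ρ : H → ℝ} {c₀ : ℝ}

/-- A measurable density with values in `{0} ∪ [1/c₀, c₀]`, almost surely different from zero. -/
structure IsEllipticDensity (μ : Measure H) (ρ : H → ℝ) (c₀ : ℝ) : Prop where
  measurable : Measurable ρ
  nonneg : ∀ z, 0 ≤ ρ z
  le : ∀ z, ρ z ≤ c₀
  inv_le : ∀ z, (ρ z)⁻¹ ≤ c₀
  ae_ne_zero : ∀ᵐ z ∂μ, ρ z ≠ 0

lemma IsEllipticDensity.integral_weighted (hρ : IsEllipticDensity μ ρ c₀) {f : H → ℝ} :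
    ∫ z, f z ∂weighted μ ρ = ∫ z, f z * ρ z ∂μ := by
  rw [weighted, integral_withDensity_eq_integral_toReal_smul hρ.measurable.ennreal_ofReal
    (ae_of_all _ fun _ => ENNReal.ofReal_lt_top)]
  refine integral_congr_ae (ae_of_all _ fun z => ?_)
  simp only [smul_eq_mul]
  rw [ENNReal.toReal_ofReal (hρ.nonneg z), mul_comm]

lemma IsEllipticDensity.weighted_le (hρ : IsEllipticDensity μ ρ c₀) :
    weighted μ ρ ≤ ENNReal.ofReal c₀ • μ := by
  rw [weighted, ← withDensity_const]
  exact withDensity_mono (ae_of_all _ fun z => ENNReal.ofReal_le_ofReal (hρ.le z))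

lemma IsEllipticDensity.isFiniteMeasure (hρ : IsEllipticDensity μ ρ c₀) :
    IsFiniteMeasure (weighted μ ρ) :=
  ⟨(hρ.weighted_le univ).trans_lt (by
    rw [Measure.smul_apply, smul_eq_mul]
    exact ENNReal.mul_lt_top ENNReal.ofReal_lt_top (measure_lt_top _ _))⟩

lemma IsEllipticDensity.memLp (hρ : IsEllipticDensity μ ρ c₀) {E : Type*} [NormedAddCommGroup E]
    {f : H → E} {p : ℝ≥0∞} (hf : MemLp f p μ) : MemLp f p (weighted μ ρ) :=
  hf.of_measure_le_smul ENNReal.ofReal_ne_top hρ.weighted_le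

/-- Fields divided by `ρ` are admissible in `L²(ρ dμ)`, and pairing with them cancels the weight. -/
lemma IsEllipticDensity.memLp_inv_smul (hρ : IsEllipticDensity μ ρ c₀) {E : Type*}
    [NormedAddCommGroup E] [NormedSpace ℝ E] {f : H → E} {p : ℝ≥0∞} (hf : MemLp f p μ) :
    MemLp (fun z => (ρ z)⁻¹ • f z) p (weighted μ ρ) := by
  refine hρ.memLp ((hf.const_smul c₀).mono
    (hρ.measurable.inv.aestronglyMeasurable.smul hf.1) (ae_of_all _ fun z => ?_))
  simp only [Pi.smul_apply, norm_smul]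
  rw [Real.norm_of_nonneg (inv_nonneg.2 (hρ.nonneg z)),
    Real.norm_of_nonneg ((inv_nonneg.2 (hρ.nonneg z)).trans (hρ.inv_le z))]
  exact mul_le_mul_of_nonneg_right (hρ.inv_le z) (norm_nonneg _)

lemma weighted_absolutelyContinuous : weighted μ ρ ≪ μ := withDensity_absolutelyContinuous _ _

lemma gradient_sub {u v : H → ℝ} (hu : Differentiable ℝ u) (hv : Differentiable ℝ v) (z : H) :
    gradient (u - v) z = gradient u z - gradient v z := by
  refine ext_inner_left ℝ fun w => ?_
  rw [inner_gradient, inner_sub_right, inner_gradient, inner_gradient, fderiv_sub (hu z) (hv z)]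
  rfl

variable [IsFiniteMeasure (weighted μ ρ)]

/-- The gradient as an element of `L²(H, H; ρ dμ)`. -/
noncomputable def gradLp (μ : Measure H) (ρ : H → ℝ) [IsFiniteMeasure (weighted μ ρ)] {u : H → ℝ}
    (hu : IsCb1 u) : Lp H 2 (weighted μ ρ) := (hu.memLp_gradient 2 (weighted μ ρ)).toLp _

lemma coeFn_gradLp {u : H → ℝ} (hu : IsCb1 u) : gradLp μ ρ hu =ᵐ[weighted μ ρ] gradient u :=
  MemLp.coeFn_toLp _

lemma IsEllipticDensity.preForm_eq (hρ : IsEllipticDensity μ ρ c₀) {u v : H → ℝ} (hu : IsCb1 u)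
    (hv : IsCb1 v) : preForm μ ρ u v = (1 / 2) * inner ℝ (gradLp μ ρ hu) (gradLp μ ρ hv) := by
  rw [preForm, L2.inner_def, ← hρ.integral_weighted]
  congr 1
  refine integral_congr_ae ?_
  filter_upwards [coeFn_gradLp hu, coeFn_gradLp hv] with z h1 h2
  rw [h1, h2]

lemma gradLp_sub {u v : H → ℝ} (hu : IsCb1 u) (hv : IsCb1 v) :
    gradLp μ ρ (u := u - v) (hu.sub hv) = gradLp μ ρ hu - gradLp μ ρ hv := by
  rw [gradLp, gradLp, gradLp, ← MemLp.toLp_sub, MemLp.toLp_eq_toLp_iff]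
  exact ae_of_all _ fun z => gradient_sub hu.1 hv.1 z

/-- Twice the form at `w m - w n` is the squared `L²` distance of the gradients, and `L²` is
complete. -/
lemma IsApproximating.exists_tendsto (hρ : IsEllipticDensity μ ρ c₀) {w : ℕ → H → ℝ} {u : H → ℝ}
    (hw : IsApproximating μ ρ w u) :
    ∃ D, Tendsto (fun n => gradLp μ ρ (hw.1 n)) atTop (𝓝 D) := by
  refine cauchySeq_tendsto_of_complete (cauchySeq_iff_tendsto_dist_atTop_0.2 ?_)
  have h : ∀ p : ℕ × ℕ, dist (gradLp μ ρ (hw.1 p.1)) (gradLp μ ρ (hw.1 p.2)) =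
      √(2 * preForm μ ρ (w p.1 - w p.2) (w p.1 - w p.2)) := by
    intro p
    rw [hρ.preForm_eq (u := w p.1 - w p.2) (v := w p.1 - w p.2) ((hw.1 _).sub (hw.1 _))
      ((hw.1 _).sub (hw.1 _)), gradLp_sub, real_inner_self_eq_norm_sq, dist_eq_norm,
      ← mul_assoc, mul_one_div_cancel two_ne_zero, one_mul, Real.sqrt_sq (norm_nonneg _)]
  simp_rw [h]
  have := (hw.2.1.const_mul 2).sqrt
  rwa [mul_zero, Real.sqrt_zero] at this

/-- The pre-Dirichlet form is closable. -/
lemma IsApproximating.limit_unique (hρ : IsEllipticDensity μ ρ c₀) {ι : Type*}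
    (e : HilbertBasis ι ℝ H) {A : H →ₗ.[ℝ] H} (hA : ∀ j, e j ∈ A.domain)
    (hadj : HasConstantAdjoint μ A) {w w' : ℕ → H → ℝ} {u : H → ℝ}
    (hw : IsApproximating μ ρ w u) (hw' : IsApproximating μ ρ w' u)
    (hu : MemLp u 2 (weighted μ ρ)) {D D' : Lp H 2 (weighted μ ρ)}
    (hD : Tendsto (fun n => gradLp μ ρ (hw.1 n)) atTop (𝓝 D))
    (hD' : Tendsto (fun n => gradLp μ ρ (hw'.1 n)) atTop (𝓝 D')) : D = D' := by
  have : Countable ι := countable_of_hilbertBasis e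
  have hconv : ∀ {v : ℕ → H → ℝ} (hv : IsApproximating μ ρ v u),
      Tendsto (fun n => ((hv.1 n).memLp 2 (weighted μ ρ)).toLp (v n)) atTop (𝓝 (hu.toLp u)) := by
    intro v hv
    rw [Lp.tendsto_Lp_iff_tendsto_eLpNorm'']
    exact hv.2.2
  -- Pairing with `ρ⁻¹ v e j` moves the derivative off the sequence by parts, so both pairings have
  -- the same limit `∫ u D^*(v e j) dμ`.
  have key : ∀ (j : ι) (v : H → ℝ) (hv : IsCb1 v) (G : Lp H 2 (weighted μ ρ)),
      G =ᵐ[weighted μ ρ] (fun z => (ρ z)⁻¹ • v z • e j) → inner ℝ D G = inner ℝ D' G := by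
    intro j v hv G hG
    have hGadj := (hadj ⟨e j, hA j⟩).smul hv
    set W : H → ℝ := fun z => v z * (2 * inner ℝ (A ⟨e j, hA j⟩) z) - inner ℝ (e j) (gradient v z)
    have hWm : MemLp (fun z => (ρ z)⁻¹ • W z) 2 (weighted μ ρ) := hρ.memLp_inv_smul hGadj.2.1
    have ibp : ∀ {x : H → ℝ} (hx : IsCb1 x), inner ℝ (gradLp μ ρ hx) G =
        inner ℝ ((hx.memLp 2 (weighted μ ρ)).toLp x) (hWm.toLp _) := by
      intro x hx
      have e1 : inner ℝ (gradLp μ ρ hx) G = ∫ z, inner ℝ (v z • e j) (gradient x z) ∂μ := by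
        rw [L2.inner_def, integral_congr_ae (g := fun z =>
          inner ℝ (gradient x z) ((ρ z)⁻¹ • v z • e j)) (by
            filter_upwards [coeFn_gradLp hx, hG] with z h1 h2
            rw [h1, h2]), hρ.integral_weighted]
        refine integral_congr_ae ?_
        filter_upwards [hρ.ae_ne_zero] with z hz
        rw [inner_smul_right, mul_comm, mul_inv_cancel_left₀ hz, real_inner_comm]
      have e2 : inner ℝ ((hx.memLp 2 (weighted μ ρ)).toLp x) (hWm.toLp _) =
          ∫ z, W z * x z ∂μ := by
        rw [L2.inner_def, integral_congr_ae (g := fun z => inner ℝ (x z) ((ρ z)⁻¹ • W z)) (by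
            filter_upwards [(hx.memLp 2 (weighted μ ρ)).coeFn_toLp, hWm.coeFn_toLp] with z h1 h2
            rw [h1, h2]), hρ.integral_weighted]
        refine integral_congr_ae ?_
        filter_upwards [hρ.ae_ne_zero] with z hz
        rw [inner_smul_right, mul_comm, mul_inv_cancel_left₀ hz]
        rfl
      rw [e1, e2]
      exact (hGadj.2.2 x hx).symm
    have t1 := Tendsto.inner (𝕜 := ℝ) hD (tendsto_const_nhds (x := G))
    have t2 := Tendsto.inner (𝕜 := ℝ) hD' (tendsto_const_nhds (x := G))
    simp_rw [ibp] at t1 t2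
    have s1 := Tendsto.inner (𝕜 := ℝ) (hconv hw) (tendsto_const_nhds (x := hWm.toLp _))
    have s2 := Tendsto.inner (𝕜 := ℝ) (hconv hw') (tendsto_const_nhds (x := hWm.toLp _))
    rw [tendsto_nhds_unique t1 s1, tendsto_nhds_unique t2 s2]
  rw [← sub_eq_zero, Lp.eq_zero_iff_ae_eq_zero]
  have hj : ∀ j, ∀ᵐ z ∂weighted μ ρ, (ρ z)⁻¹ * inner ℝ ((D - D' : Lp H 2 (weighted μ ρ)) z)
      (e j) = 0 := by
    intro j
    refine ae_eq_zero_of_forall_integral_mul_eq_zero (w := fun z =>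
      (ρ z)⁻¹ * inner ℝ ((D - D' : Lp H 2 (weighted μ ρ)) z) (e j)) ?_ fun v hv => ?_
    · have := integrable_inner_of_memLp (Lp.memLp (D - D'))
        (hρ.memLp_inv_smul (memLp_const (e j)) : MemLp (fun z => (ρ z)⁻¹ • e j) 2 (weighted μ ρ))
      simpa [inner_smul_right] using this
    · have hGm : MemLp (fun z => (ρ z)⁻¹ • v z • e j) 2 (weighted μ ρ) :=
        hρ.memLp_inv_smul ((hadj ⟨e j, hA j⟩).smul hv).1
      have h := key j v hv (hGm.toLp _) hGm.coeFn_toLp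
      rw [← sub_eq_zero, ← inner_sub_left, L2.inner_def] at h
      rw [← h]
      refine integral_congr_ae ?_
      filter_upwards [hGm.coeFn_toLp] with z hz
      rw [hz, inner_smul_right, inner_smul_right]
      ring
  filter_upwards [ae_all_iff.2 hj, weighted_absolutelyContinuous.ae_le hρ.ae_ne_zero] with z hz h0
  refine e.repr.injective ?_
  ext j
  have := hz j
  rw [mul_eq_zero, or_iff_right (inv_ne_zero h0)] at this
  rw [e.repr_apply_apply, real_inner_comm, this]
  simp

/-- The closed form is computed along any approximating sequences. -/
lemma IsEllipticDensity.closedForm_eq (hρ : IsEllipticDensity μ ρ c₀) {ι : Type*}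
    (e : HilbertBasis ι ℝ H) {A : H →ₗ.[ℝ] H} (hA : ∀ j, e j ∈ A.domain)
    (hadj : HasConstantAdjoint μ A) {w w' : ℕ → H → ℝ} {u u' : H → ℝ}
    (hw : IsApproximating μ ρ w u) (hw' : IsApproximating μ ρ w' u')
    (hu : MemLp u 2 (weighted μ ρ)) (hu' : MemLp u' 2 (weighted μ ρ))
    {D D' : Lp H 2 (weighted μ ρ)}
    (hD : Tendsto (fun n => gradLp μ ρ (hw.1 n)) atTop (𝓝 D))
    (hD' : Tendsto (fun n => gradLp μ ρ (hw'.1 n)) atTop (𝓝 D')) :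
    closedForm μ ρ u u' = (1 / 2) * inner ℝ D D' := by
  have h : MemFormDomain μ ρ u ∧ MemFormDomain μ ρ u' := ⟨⟨hu, w, hw⟩, ⟨hu', w', hw'⟩⟩
  rw [closedForm, dif_pos h]
  have h1 := h.1.2.choose_spec
  have h2 := h.2.2.choose_spec
  -- The sequences inside `closedForm` are arbitrary choices; closability identifies their gradient
  -- limits with `D` and `D'`.
  obtain ⟨E, hE⟩ := h1.exists_tendsto hρ
  obtain ⟨E', hE'⟩ := h2.exists_tendsto hρ
  have e1 : E = D := h1.limit_unique hρ e hA hadj hw hu hE hD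
  have e2 : E' = D' := h2.limit_unique hρ e hA hadj hw' hu' hE' hD'
  subst e1 e2
  refine Tendsto.limUnder_eq ?_
  simp_rw [fun n => hρ.preForm_eq (h1.1 n) (h2.1 n)]
  exact (Tendsto.inner (𝕜 := ℝ) hE hE').const_mul _

lemma isApproximating_const {u : H → ℝ} (hu : IsCb1 u) : IsApproximating μ ρ (fun _ => u) u := by
  refine ⟨fun _ => hu, ?_, ?_⟩
  · have : preForm μ ρ (u - u) (u - u) = 0 := by
      rw [preForm]
      simp_rw [gradient_sub hu.1 hu.1, sub_self]
      simp
    exact tendsto_const_nhds.congr fun _ => this.symm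
  · simp

/-! ### Linear functionals in the form domain -/

lemma tendsto_eLpNorm_zero_of_le {E : Type*} [NormedAddCommGroup E] {ν : Measure H}
    {f : ℕ → H → E} {B : H → ℝ} (hB : MemLp B 2 ν)
    (h : ∀ n z, ‖f n z‖ ≤ (1 / ((n : ℝ) + 1)) * B z) :
    Tendsto (fun n => eLpNorm (f n) 2 ν) atTop (𝓝 0) := by
  have hle : ∀ n : ℕ, eLpNorm (f n) 2 ν ≤ ENNReal.ofReal (1 / ((n : ℝ) + 1)) * eLpNorm B 2 ν := by
    intro n
    refine (eLpNorm_mono_real (h n)).trans (le_of_eq ?_)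
    have := eLpNorm_const_smul (1 / ((n : ℝ) + 1)) B 2 ν
    rw [Real.enorm_of_nonneg (by positivity)] at this
    exact this
  have ht : Tendsto (fun n : ℕ => ENNReal.ofReal (1 / ((n : ℝ) + 1)) * eLpNorm B 2 ν) atTop
      (𝓝 (0 * eLpNorm B 2 ν)) := by
    refine ENNReal.Tendsto.mul_const ?_ (Or.inr hB.2.ne)
    simpa [Function.comp_def] using (ENNReal.continuous_ofReal.tendsto 0).comp
      (tendsto_one_div_add_atTop_nhds_zero_nat (𝕜 := ℝ))
  rw [zero_mul] at ht
  exact tendsto_of_tendsto_of_tendsto_of_le_of_le tendsto_const_nhds ht (fun _ => zero_le) hle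

/-- The approximation `n sin(⟨l, ·⟩ / n)` of the linear functional `⟨l, ·⟩`. -/
noncomputable def sinApprox (l : H) (n : ℕ) (z : H) : ℝ :=
  ((n : ℝ) + 1) * Real.sin (inner ℝ l z / ((n : ℝ) + 1))

lemma hasFDerivAt_sinApprox (l : H) (n : ℕ) (z : H) :
    HasFDerivAt (sinApprox l n) (Real.cos (inner ℝ l z / ((n : ℝ) + 1)) • innerSL ℝ l) z := by
  have hn : (n : ℝ) + 1 ≠ 0 := by positivity
  have h : HasFDerivAt (fun z => inner ℝ l z / ((n : ℝ) + 1))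
      (((n : ℝ) + 1)⁻¹ • innerSL ℝ l) z := by
    simpa [div_eq_inv_mul] using ((innerSL ℝ l).hasFDerivAt (x := z)).const_mul ((n : ℝ) + 1)⁻¹
  refine (h.sin.const_mul ((n : ℝ) + 1)).congr_fderiv ?_
  rw [smul_smul, smul_smul]
  congr 1
  field_simp

lemma isCb1_sinApprox (l : H) (n : ℕ) : IsCb1 (sinApprox l n) := by
  refine isCb1_of_hasFDerivAt (C := (n : ℝ) + 1) (C' := ‖innerSL ℝ l‖) (hasFDerivAt_sinApprox l n)
    (fun z => ?_) (fun z => ?_)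
  · rw [sinApprox, abs_mul, abs_of_pos (by positivity)]
    exact mul_le_of_le_one_right (by positivity) (Real.abs_sin_le_one _)
  · rw [norm_smul]
    exact mul_le_of_le_one_left (norm_nonneg _) (Real.abs_cos_le_one _)

lemma gradient_sinApprox (l : H) (n : ℕ) (z : H) :
    gradient (sinApprox l n) z = Real.cos (inner ℝ l z / ((n : ℝ) + 1)) • l := by
  refine ext_inner_left ℝ fun w => ?_
  rw [inner_gradient, (hasFDerivAt_sinApprox l n z).fderiv, inner_smul_right]
  simp [real_inner_comm]

lemma IsEllipticDensity.tendsto_gradLp_sinApprox [IsGaussian μ] (hρ : IsEllipticDensity μ ρ c₀)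
    (l : H) : Tendsto (fun n => gradLp μ ρ (isCb1_sinApprox l n)) atTop
      (𝓝 ((memLp_const l : MemLp (fun _ => l) 2 (weighted μ ρ)).toLp _)) := by
  refine (Lp.tendsto_Lp_iff_tendsto_eLpNorm'' _ _ _ _).2 ?_
  refine tendsto_eLpNorm_zero_of_le
    (B := fun z => ‖inner ℝ l z‖ * ‖l‖) ((hρ.memLp (memLp_inner μ l)).norm.mul_const _)
    fun n z => ?_
  have hn : (0 : ℝ) < (n : ℝ) + 1 := by positivity
  rw [Pi.sub_apply, gradient_sinApprox]
  rw [show ∀ a : ℝ, a • l - l = (a - 1) • l from fun a => by rw [sub_smul, one_smul],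
    norm_smul, ← mul_assoc]
  refine mul_le_mul_of_nonneg_right ?_ (norm_nonneg _)
  have h := Real.abs_cos_sub_cos_le (inner ℝ l z / ((n : ℝ) + 1)) 0
  rw [Real.cos_zero, sub_zero, abs_div, abs_of_pos hn] at h
  rw [Real.norm_eq_abs, Real.norm_eq_abs, one_div, ← div_eq_inv_mul]
  exact h

lemma IsEllipticDensity.isApproximating_sinApprox [IsGaussian μ] (hρ : IsEllipticDensity μ ρ c₀)
    (l : H) : IsApproximating μ ρ (sinApprox l) (fun z => inner ℝ l z) := by
  refine ⟨isCb1_sinApprox l, ?_, ?_⟩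
  · have hc := (hρ.tendsto_gradLp_sinApprox l).cauchySeq
    have h : ∀ p : ℕ × ℕ, preForm μ ρ (sinApprox l p.1 - sinApprox l p.2)
        (sinApprox l p.1 - sinApprox l p.2) = (1 / 2) * dist (gradLp μ ρ (isCb1_sinApprox l p.1))
          (gradLp μ ρ (isCb1_sinApprox l p.2)) ^ 2 := by
      intro p
      rw [hρ.preForm_eq (u := sinApprox l p.1 - sinApprox l p.2)
        (v := sinApprox l p.1 - sinApprox l p.2)
        ((isCb1_sinApprox l _).sub (isCb1_sinApprox l _))
        ((isCb1_sinApprox l _).sub (isCb1_sinApprox l _)), gradLp_sub,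
        real_inner_self_eq_norm_sq, dist_eq_norm]
    simp_rw [h]
    have := ((cauchySeq_iff_tendsto_dist_atTop_0.1 hc).pow 2).const_mul (1 / 2)
    rwa [zero_pow two_ne_zero, mul_zero] at this
  -- From `|y - sin y| ≤ |y|³ / 6` the error is at most `|⟨l, z⟩|³ / (n + 1)`, square integrable
  -- because Gaussian measures have sixth moments.
  · have hB : MemLp (fun z => |inner ℝ l z| ^ 3) 2 μ := by
      have h6 : MemLp (fun z => inner ℝ l z) 6 μ :=
        IsGaussian.memLp_dual μ (innerSL ℝ l) 6 (by simp)
      have hm : AEStronglyMeasurable (fun z => |inner ℝ l z| ^ 3) μ :=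
        (by fun_prop : Continuous fun z : H => |inner ℝ l z| ^ 3).aestronglyMeasurable
      rw [memLp_two_iff_integrable_sq hm]
      have := h6.integrable_norm_pow (p := 6) (by norm_num)
      refine this.congr (ae_of_all _ fun z => ?_)
      simp only [Real.norm_eq_abs]
      ring
    refine tendsto_eLpNorm_zero_of_le (hρ.memLp hB) fun n z => ?_
    have hn : (1 : ℝ) ≤ (n : ℝ) + 1 := by linarith [(Nat.cast_nonneg n : (0 : ℝ) ≤ n)]
    set x : ℝ := inner ℝ l z
    have hs := Real.abs_sub_sin_le (x / ((n : ℝ) + 1))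
    have e1 : (sinApprox l n - fun z => inner ℝ l z) z =
        -(((n : ℝ) + 1) * (x / ((n : ℝ) + 1) - Real.sin (x / ((n : ℝ) + 1)))) := by
      rw [Pi.sub_apply, sinApprox]
      field_simp
      ring
    rw [e1, norm_neg, norm_mul, Real.norm_of_nonneg (by positivity), Real.norm_eq_abs]
    refine (mul_le_mul_of_nonneg_left hs (by positivity)).trans ?_
    rw [abs_div, abs_of_pos (by positivity : (0 : ℝ) < (n : ℝ) + 1), div_pow]
    have e2 : ((n : ℝ) + 1) * (|x| ^ 3 / ((n : ℝ) + 1) ^ 3 / 6) =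
        (1 / ((n : ℝ) + 1)) * |x| ^ 3 * (1 / (6 * ((n : ℝ) + 1))) := by
      field_simp
    rw [e2]
    refine mul_le_of_le_one_right (by positivity) ?_
    rw [div_le_one (by positivity)]
    linarith

end ClosedForm

/-! ### Summation by parts -/

section Abel

lemma sum_Ico_neg_succ (f : ℤ → ℝ) (N : ℕ) :
    ∑ k ∈ Finset.Ico (-((N + 1 : ℕ) : ℤ)) ((N + 1 : ℕ) : ℤ), f k =
      f (-((N + 1 : ℕ) : ℤ)) + f N + ∑ k ∈ Finset.Ico (-(N : ℤ)) N, f k := by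
  have : Finset.Ico (-((N + 1 : ℕ) : ℤ)) ((N + 1 : ℕ) : ℤ) =
      insert (-((N + 1 : ℕ) : ℤ)) (insert (N : ℤ) (Finset.Ico (-(N : ℤ)) N)) := by
    ext k
    simp only [Finset.mem_Ico, Finset.mem_insert]
    omega
  rw [this, Finset.sum_insert, Finset.sum_insert, add_assoc]
  · simp
  · simp only [Finset.mem_Ico, Finset.mem_insert]
    omega

lemma sum_Ico_neg_by_parts (γ a : ℤ → ℝ) (N : ℕ) :
    ∑ k ∈ Finset.Ico (-(N : ℤ)) N, γ (k + 1) * (a (k + 1) - a k) =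
      γ N * a N - γ (-(N : ℤ)) * a (-(N : ℤ)) -
        ∑ k ∈ Finset.Ico (-(N : ℤ)) N, (γ (k + 1) - γ k) * a k := by
  induction N with
  | zero => simp
  | succ N ih =>
    rw [sum_Ico_neg_succ, sum_Ico_neg_succ, ih]
    have : -((N + 1 : ℕ) : ℤ) + 1 = -(N : ℤ) := by push_cast; ring
    rw [this, Nat.cast_succ]
    ring

variable {X : Type*} [MeasurableSpace X] {μ : Measure X} [IsFiniteMeasure μ] {Γ : ℤ → Set X}
  {γ : ℤ → ℝ}

/-- Abel summation over `-N ≤ k < N`, with domination by `c₀ |F|`. The boundary terms vanish because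
`γ` is bounded, `F` has mean zero, and the measures of `Γ (-N)` and of the complement of `Γ N` tend
to zero. -/
lemma integral_mul_stepDensity (hΓ : Monotone Γ) (hm : ∀ k, MeasurableSet (Γ k))
    (hbot : Tendsto (fun k => μ (Γ k)) atBot (𝓝 0))
    (htop : Tendsto (fun k => μ (Γ k)) atTop (𝓝 (μ univ))) {c₀ : ℝ} (hγ0 : ∀ k, 0 ≤ γ k)
    (hγ : ∀ k, γ k ≤ c₀) {F : X → ℝ} (hF : Integrable F μ) (hF0 : ∫ z, F z ∂μ = 0)
    (hs : Summable fun k : ℤ => (γ (k + 1) - γ k) * ∫ z in Γ k, F z ∂μ) :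
    ∫ z, F z * stepDensity Γ γ z ∂μ = -∑' k : ℤ, (γ (k + 1) - γ k) * ∫ z in Γ k, F z ∂μ := by
  set a : ℤ → ℝ := fun k => ∫ z in Γ k, F z ∂μ with ha
  have hIco : Tendsto (fun N : ℕ => Finset.Ico (-(N : ℤ)) N) atTop atTop := Finset.tendsto_Ico_neg
  have hρle : ∀ z, stepDensity Γ γ z ≤ c₀ := fun z => by
    rcases stepDensity_eq_zero_or hΓ γ z with h | ⟨k, h⟩ <;> rw [h]
    exacts [(hγ0 0).trans (hγ 0), hγ k]
  have hind0 : ∀ (k : ℤ) z, 0 ≤ (Γ (k + 1) \ Γ k).indicator (fun _ => γ (k + 1)) z := fun k z =>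
    indicator_nonneg (fun _ _ => hγ0 _) z
  have hpart : ∀ N : ℕ, ∫ z, F z * ∑ k ∈ Finset.Ico (-(N : ℤ)) N,
      (Γ (k + 1) \ Γ k).indicator (fun _ => γ (k + 1)) z ∂μ =
        ∑ k ∈ Finset.Ico (-(N : ℤ)) N, γ (k + 1) * (a (k + 1) - a k) := by
    intro N
    have e1 : ∀ (k : ℤ) z, F z * (Γ (k + 1) \ Γ k).indicator (fun _ => γ (k + 1)) z =
        (Γ (k + 1) \ Γ k).indicator (fun z => γ (k + 1) * F z) z := by
      intro k z
      by_cases hz : z ∈ Γ (k + 1) \ Γ k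
      · rw [indicator_of_mem hz, indicator_of_mem hz, mul_comm]
      · rw [indicator_of_notMem hz, indicator_of_notMem hz, mul_zero]
    simp_rw [Finset.mul_sum, e1]
    rw [integral_finsetSum _ fun k _ => (hF.const_mul _).indicator ((hm _).diff (hm _))]
    refine Finset.sum_congr rfl fun k _ => ?_
    rw [integral_indicator ((hm _).diff (hm _)), integral_const_mul,
      setIntegral_sdiff (hm _) hF.integrableOn (hΓ (by omega))]
  have hL : Tendsto (fun N : ℕ => ∫ z, F z * ∑ k ∈ Finset.Ico (-(N : ℤ)) N,
      (Γ (k + 1) \ Γ k).indicator (fun _ => γ (k + 1)) z ∂μ) atTop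
        (𝓝 (∫ z, F z * stepDensity Γ γ z ∂μ)) := by
    refine tendsto_integral_of_dominated_convergence (fun z => c₀ * ‖F z‖) (fun N => ?_)
      (hF.norm.const_mul _) (fun N => ae_of_all _ fun z => ?_) (ae_of_all _ fun z => ?_)
    · exact hF.aestronglyMeasurable.mul (Finset.measurable_sum _ fun k _ =>
        measurable_const.indicator ((hm _).diff (hm _))).aestronglyMeasurable
    · have h0 := Finset.sum_nonneg fun k (_ : k ∈ Finset.Ico (-(N : ℤ)) N) => hind0 k z
      rw [norm_mul, mul_comm, Real.norm_of_nonneg h0]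
      refine mul_le_mul_of_nonneg_right (le_trans ?_ (hρle z)) (norm_nonneg _)
      exact sum_le_hasSum _ (fun k _ => hind0 k z) (hasSum_stepDensity hΓ γ z)
    · exact ((hasSum_stepDensity hΓ γ z).comp hIco).const_mul (F z)
  have hz : ∀ b : ℕ → ℤ, Tendsto (fun N => a (b N)) atTop (𝓝 0) →
      Tendsto (fun N => γ (b N) * a (b N)) atTop (𝓝 0) := by
    intro b hb
    refine squeeze_zero_norm (a := fun N => c₀ * ‖a (b N)‖) (fun N => ?_) ?_
    · rw [norm_mul, Real.norm_of_nonneg (hγ0 _)]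
      exact mul_le_mul_of_nonneg_right (hγ _) (norm_nonneg _)
    · simpa using hb.norm.const_mul c₀
  have hcast : Tendsto (fun N : ℕ => (N : ℤ)) atTop atTop := tendsto_natCast_atTop_atTop
  -- Mean zero gives `a N = -∫ F` over the complement of `Γ N`, whose measure tends to zero.
  have h1 : Tendsto (fun N : ℕ => a N) atTop (𝓝 0) := by
    have hc : Tendsto (fun N : ℕ => μ (Γ N)ᶜ) atTop (𝓝 0) := by
      simp_rw [fun N : ℕ => measure_compl (hm (N : ℤ)) (measure_ne_top μ _)]
      have := ENNReal.Tendsto.sub (tendsto_const_nhds (x := μ univ)) (htop.comp hcast)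
        (Or.inl (measure_ne_top _ _))
      simpa using this
    have h2 := (hF.tendsto_setIntegral_nhds_zero hc).neg
    rw [neg_zero] at h2
    refine h2.congr fun N => ?_
    have := integral_add_compl (hm (N : ℤ)) hF
    rw [hF0] at this
    linarith
  have h2 : Tendsto (fun N : ℕ => a (-(N : ℤ))) atTop (𝓝 0) :=
    hF.tendsto_setIntegral_nhds_zero (hbot.comp (tendsto_neg_atTop_atBot.comp hcast))
  have hR := ((hz _ h1).sub (hz _ h2)).sub (hs.hasSum.comp hIco)
  refine tendsto_nhds_unique (hL.congr fun N => (hpart N).trans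
    (sum_Ico_neg_by_parts γ a N)) ?_
  simpa [Function.comp_def] using hR

end Abel

end SkewOU
-- The integration by parts formula
theorem mainTheorem8
    {H : Type*} [NormedAddCommGroup H] [InnerProductSpace ℝ H] [CompleteSpace H]
    [SecondCountableTopology H] [MeasurableSpace H] [BorelSpace H]
    -- the self-adjoint operator `A ≥ δ` with trace class inverse
    (A : H →ₗ.[ℝ] H) (hA : IsSelfAdjoint A)
    (δ : ℝ) (hδ : 0 < δ) (hAδ : ∀ x : A.domain, δ * ‖(x : H)‖ ^ 2 ≤ inner ℝ (A x) (x : H))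
    (Ainv : H →L[ℝ] H) (hAinv : IsInverse A Ainv) (htr : IsTraceClass Ainv)
    -- the orthonormal basis of eigenvectors and the weights that define `H₁`
    {ι : Type*} (e : HilbertBasis ι ℝ H) (α : ι → ℝ)
    (he : ∀ j, ∃ h : e j ∈ A.domain, A ⟨e j, h⟩ = α j • e j)
    (c : ι → Set.Ici (1 : ℝ))
    -- the centered Gaussian measure with covariance operator `½ A⁻¹`
    (μ : Measure H) [IsGaussian μ] (hmean : ∫ z, z ∂μ = 0)
    (hcov : covarianceOperator μ = (1 / 2 : ℝ) • Ainv)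
    -- the closed convex sets and the values of the step function
    (Γ : ℤ → Set H) (hmono : ∀ k, Γ k ⊆ Γ (k + 1))
    (hclosed : ∀ k, IsClosed (Γ k)) (hconvex : ∀ k, Convex ℝ (Γ k))
    (hBV : ∀ k, IsBV μ A e c ((Γ k).indicator 1))
    (hbot : Tendsto (fun k => μ (Γ k)) atBot (𝓝 0))
    (htop : Tendsto (fun k => μ (Γ k)) atTop (𝓝 (μ univ)))
    (γ : ℤ → ℝ) (hγ : ∃ c₀ : ℝ, 1 < c₀ ∧ ∀ k, 1 / c₀ ≤ γ k ∧ γ k ≤ c₀)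
    (hγlim : ∃ γbar : ℝ, Tendsto γ atTop (𝓝 γbar))
    (hsum : ∑' k : ℤ, ENNReal.ofReal |γ (k + 1) - γ k| *
      surfaceMeasure μ A e c (Γ k) (frontier (Γ k)) < ⊤)
    -- the direction `l ∈ D(A) ∩ H₁` and the test function `g`
    (l : H1 e c) (hl : H1.incl e c l ∈ A.domain) (g : H → ℝ) (hg : IsCb1 g) :
    -- the surface measures and normals exist
    (∀ k, IsSurfacePair μ A e c (Γ k)
      (surfaceMeasure μ A e c (Γ k)) (exteriorNormal μ A e c (Γ k))) ∧
    -- every term of the formula is well defined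
    MemFormDomain μ (stepDensity Γ γ) (fun z => inner ℝ (H1.incl e c l) z) ∧
    MemFormDomain μ (stepDensity Γ γ) g ∧
    Integrable (fun z => g z * inner ℝ (A ⟨H1.incl e c l, hl⟩) z * stepDensity Γ γ z) μ ∧
    (∀ k, IntegrableOn (fun z => g z * exteriorNormal μ A e c (Γ k) z l) (frontier (Γ k))
      (surfaceMeasure μ A e c (Γ k))) ∧
    (Summable fun k : ℤ => ∫ z in frontier (Γ k),
      g z * exteriorNormal μ A e c (Γ k) z l * (γ (k + 1) - γ k)
        ∂((1 / 2 : ℝ≥0∞) • surfaceMeasure μ A e c (Γ k))) ∧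
    -- the integration by parts formula
    -closedForm μ (stepDensity Γ γ) (fun z => inner ℝ (H1.incl e c l) z) g =
      -(∫ z, g z * inner ℝ (A ⟨H1.incl e c l, hl⟩) z * stepDensity Γ γ z ∂μ) +
        ∑' k : ℤ, ∫ z in frontier (Γ k),
          g z * exteriorNormal μ A e c (Γ k) z l * (γ (k + 1) - γ k)
            ∂((1 / 2 : ℝ≥0∞) • surfaceMeasure μ A e c (Γ k)) := by
  obtain ⟨c₀, hc₀, hγb⟩ := hγ
  have hc₀pos : 0 < c₀ := one_pos.trans hc₀
  have hγpos : ∀ k, 0 < γ k := fun k => (by positivity : 0 < 1 / c₀).trans_le (hγb k).1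
  have hadj : HasConstantAdjoint μ A := hasConstantAdjoint hmean hAinv hcov
  have hA' : ∀ j, e j ∈ A.domain := fun j => (he j).1
  have hΓ : Monotone Γ := monotone_int_of_le_succ hmono
  have hm : ∀ k, MeasurableSet (Γ k) := fun k => (hclosed k).measurableSet
  have hρ : IsEllipticDensity μ (stepDensity Γ γ) c₀ := by
    refine ⟨measurable_stepDensity hΓ hm, fun z => ?_, fun z => ?_, fun z => ?_, ?_⟩
    · rcases stepDensity_eq_zero_or hΓ γ z with h | ⟨k, h⟩ <;> rw [h]
      exact (hγpos k).le
    · rcases stepDensity_eq_zero_or hΓ γ z with h | ⟨k, h⟩ <;> rw [h]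
      exacts [hc₀pos.le, (hγb k).2]
    · rcases stepDensity_eq_zero_or hΓ γ z with h | ⟨k, h⟩ <;> rw [h]
      -- Outside all rings `ρ` is zero, and the convention `0⁻¹ = 0` keeps the bound on `ρ⁻¹` valid
      -- everywhere.
      · rw [inv_zero]; exact hc₀pos.le
      · rw [inv_le_comm₀ (hγpos k) hc₀pos, ← one_div]; exact (hγb k).1
    · filter_upwards [ae_exists_mem_sdiff hΓ hm hbot htop] with z ⟨k, hk⟩
      rw [stepDensity_eq hΓ γ hk]
      exact (hγpos _).ne'
  have hfin := hρ.isFiniteMeasure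
  have hpair : ∀ k, IsSurfacePair μ A e c (Γ k)
      (surfaceMeasure μ A e c (Γ k)) (exteriorNormal μ A e c (Γ k)) := fun k => by
    have hex := exists_isSurfacePair hA' hadj (hclosed k) (hBV k).2
    simp only [surfaceMeasure, exteriorNormal, surfacePair, dif_pos hex]
    exact hex.choose_spec
  have hlmem : MemLp (fun z => inner ℝ (H1.incl e c l) z) 2 (weighted μ (stepDensity Γ γ)) :=
    hρ.memLp (memLp_inner μ _)
  have hlapp := hρ.isApproximating_sinApprox (H1.incl e c l)
  have hgapp : IsApproximating μ (stepDensity Γ γ) (fun _ => g) g := isApproximating_const hg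
  obtain ⟨C, hC0, hC⟩ := hg.exists_bound
  obtain ⟨C', hC0', hC'⟩ := hg.exists_fderiv_bound
  have hρb : ∀ᵐ z ∂μ, ‖stepDensity Γ γ z‖ ≤ c₀ := ae_of_all _ fun z => by
    rw [Real.norm_of_nonneg (hρ.nonneg z)]; exact hρ.le z
  have hi1 : Integrable (fun z => g z * inner ℝ (A ⟨H1.incl e c l, hl⟩) z) μ :=
    ((memLp_inner μ _).integrable one_le_two).bdd_mul hg.measurable.aestronglyMeasurable
      (ae_of_all _ hC)
  have hi1ρ := hi1.mul_bdd hρ.measurable.aestronglyMeasurable hρb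
  have hadjl := (hadj ⟨_, hl⟩).smul hg
  have hi2 : Integrable (fun z => inner ℝ (H1.incl e c l) (gradient g z)) μ :=
    (hadj ⟨_, hl⟩).integrable_inner hg
  have hi2ρ := hi2.mul_bdd hρ.measurable.aestronglyMeasurable hρb
  have hform : closedForm μ (stepDensity Γ γ) (fun z => inner ℝ (H1.incl e c l) z) g =
      (1 / 2) * ∫ z, inner ℝ (H1.incl e c l) (gradient g z) * stepDensity Γ γ z ∂μ := by
    rw [hρ.closedForm_eq e hA' hadj hlapp hgapp hlmem (hg.memLp 2 _)
      (hρ.tendsto_gradLp_sinApprox _)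
      (D' := gradLp μ (stepDensity Γ γ) hg) tendsto_const_nhds, L2.inner_def, ← hρ.integral_weighted]
    congr 1
    refine integral_congr_ae ?_
    filter_upwards [coeFn_gradLp (μ := μ) (ρ := stepDensity Γ γ) hg,
      MemLp.coeFn_toLp (memLp_const (H1.incl e c l) :
        MemLp (fun _ => H1.incl e c l) 2 (weighted μ (stepDensity Γ γ)))] with z h1 h2
    rw [h1, h2]
  have hηm : ∀ k, Measurable fun z => exteriorNormal μ A e c (Γ k) z l := fun k =>
    (ContinuousLinearMap.measurable_apply l).comp (hpair k).measurable_normal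
  have hbound : ∀ k, ∀ᵐ z ∂(surfaceMeasure μ A e c (Γ k)).restrict (frontier (Γ k)),
      ‖g z * exteriorNormal μ A e c (Γ k) z l‖ ≤ C * ‖l‖ := fun k => by
    filter_upwards [(hpair k).norm_normal] with z hz
    rw [norm_mul]
    refine mul_le_mul (hC z) ?_ (norm_nonneg _) hC0
    have := (exteriorNormal μ A e c (Γ k) z).le_opNorm l
    rwa [hz, one_mul] at this
  have hterm : ∀ k, ∫ z in frontier (Γ k),
      g z * exteriorNormal μ A e c (Γ k) z l * (γ (k + 1) - γ k)
        ∂((1 / 2 : ℝ≥0∞) • surfaceMeasure μ A e c (Γ k)) =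
      (1 / 2) * ((γ (k + 1) - γ k) * ∫ z in frontier (Γ k),
        g z * exteriorNormal μ A e c (Γ k) z l ∂surfaceMeasure μ A e c (Γ k)) := fun k => by
    rw [Measure.restrict_smul, integral_smul_measure, integral_mul_const]
    simp
    ring
  -- The Gauss formula for the test field `g • l`, with `D^*(g l)` replaced by its explicit
  -- representative.
  have hgauss : ∀ k, ∫ z in frontier (Γ k),
      g z * exteriorNormal μ A e c (Γ k) z l ∂surfaceMeasure μ A e c (Γ k) =
        -∫ z in Γ k, (g z * (2 * inner ℝ (A ⟨H1.incl e c l, hl⟩) z) -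
          inner ℝ (H1.incl e c l) (gradient g z)) ∂μ := fun k => by
    have h := (hpair k).gauss _ (isTestField_smul_const hg hl)
    have hadjl' := hadjl
    simp_rw [← map_smul (H1.incl e c)] at hadjl'
    have h2 := flux_eq_of_isAdjointAt (Γ := Γ k) hadjl'
    rw [flux, h] at h2
    rw [← h2, neg_neg]
    refine integral_congr_ae (ae_of_all _ fun z => ?_)
    simp
  -- With a unit normal each surface integral is at most `C ‖l‖` times the surface mass, so `hsum`
  -- dominates the series.
  have hsum' : Summable fun k : ℤ => (γ (k + 1) - γ k) * ∫ z in frontier (Γ k),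
      g z * exteriorNormal μ A e c (Γ k) z l ∂surfaceMeasure μ A e c (Γ k) := by
    refine Summable.of_norm_bounded ((ENNReal.summable_toReal hsum.ne).mul_right (C * ‖l‖))
      fun k => ?_
    have := (hpair k).finite
    rw [norm_mul, ENNReal.toReal_mul, ENNReal.toReal_ofReal (abs_nonneg _), mul_assoc,
      Real.norm_eq_abs (γ (k + 1) - γ k)]
    refine mul_le_mul_of_nonneg_left ?_ (abs_nonneg _)
    have h := norm_integral_le_of_norm_le_const (hbound k)
    rw [measureReal_restrict_apply_univ, mul_comm] at h
    exact h
  have hparts := integral_mul_stepDensity hΓ hm hbot htop (fun k => (hγpos k).le)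
    (fun k => (hγb k).2) hadjl.integrable hadjl.integral_eq_zero (by
      refine hsum'.neg.congr fun k => ?_
      rw [hgauss, mul_neg, neg_neg])
  refine ⟨hpair, ⟨hlmem, _, hlapp⟩, ⟨hg.memLp 2 _, _, hgapp⟩, hi1ρ, fun k => ?_, ?_, ?_⟩
  · have := (hpair k).finite
    exact Integrable.of_bound (hg.measurable.mul (hηm k)).aestronglyMeasurable _ (hbound k)
  · simp_rw [hterm]
    exact hsum'.mul_left _
  · simp_rw [hterm]
    rw [tsum_mul_left, hform]
    have e1 : ∑' k : ℤ, (γ (k + 1) - γ k) * ∫ z in frontier (Γ k),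
        g z * exteriorNormal μ A e c (Γ k) z l ∂surfaceMeasure μ A e c (Γ k) =
          ∫ z, (g z * (2 * inner ℝ (A ⟨H1.incl e c l, hl⟩) z) -
            inner ℝ (H1.incl e c l) (gradient g z)) * stepDensity Γ γ z ∂μ := by
      rw [hparts, ← tsum_neg]
      refine tsum_congr fun k => ?_
      rw [hgauss, mul_neg]
    have e2 : ∫ z, (g z * (2 * inner ℝ (A ⟨H1.incl e c l, hl⟩) z) -
        inner ℝ (H1.incl e c l) (gradient g z)) * stepDensity Γ γ z ∂μ =
          2 * ∫ z, g z * inner ℝ (A ⟨H1.incl e c l, hl⟩) z * stepDensity Γ γ z ∂μ -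
            ∫ z, inner ℝ (H1.incl e c l) (gradient g z) * stepDensity Γ γ z ∂μ := by
      rw [← integral_const_mul, ← integral_sub (hi1ρ.const_mul 2) hi2ρ]
      congr 1; ext z; ring
    rw [e1, e2]
    ring
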